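/- Let $\mathcal A$ be a unital, possibly non-commutative algebra over $\mathbb R$ (or $\mathbb C$) with a unital linear functional $\varphi$ (no positivity is assumed). For $X_1,\dots,X_n\in\mathcal A$ the multivariate free Appell polynomials $A_{X_1,\dots,X_n}(x_1,\dots,x_n)$, in non-commuting variables, are the unique polynomials with $A_\emptyset=1$, $\partial_i A_{X_1,\dots,X_n}=A_{X_1,\dots,X_{i-1}}(x_1,\dots,x_{i-1})\,A_{X_{i+1},\dots,X_n}(x_{i+1},\dots,x_n)$ (where $\partial_i$ of a monomial is the sum over the occurrences of $x_i$ of the monomial with that occurrence omitted), $\varphi\bigl(A_{X_1,\dots,X_n}(X_1,\dots,X_n)\bigr)=0$ for $n\ge 1$, and in each monomial of which the variables appear in the increasing order of indices. Write $A(X_1,\dots,X_n)=A_{X_1,\dots,X_n}(X_1,\dots,X_n)$, and $A(X_{\vec u})=A(X_{u(1)},\dots,X_{u(m)})$ for a word $\vec u=(u(1),\dots,u(m))$. In one variable, $A^{(n)}_X(x)$ is given by $\sum_{n\ge0}A^{(n)}_X(x)z^n=\bigl(1-xz+\mathbf R_X(z)\bigr)^{-1}$, where the free cumulant generating function $\mathbf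 R_X$ (with zero constant term) is determined by the moments $m_k=\varphi(X^k)$ through $1+\mathbf R_X(zM(z))=M(z)$, $M(z)=\sum_{k\ge0}m_kz^k$; write $A^{(n)}(X)=A^{(n)}_X(X)$. Subalgebras are freely independent if $\varphi(a_1a_2\cdots a_m)=0$ for all $m\geq 1$ whenever each $a_j$ is in one of the subalgebras, neighbouring factors are taken from different ones, and all $\varphi(a_j)=0$; families of elements are freely independent if the unital subalgebras which they generate are. 1. Let $X_1,\dots,X_n\in\mathcal A$ and let $\pi$ be a partition of $\{1,\dots,n\}$ such that the collections $\{X_i:i\in B\}$, $B\in\pi$, are freely independent. Let $\vec u$ be a word in $\{1,\dots,n\}$ and write $\vec u=(\vec v_1,\dots,\vec v_k)$ with each $\vec v_i$ a longest consecutive piece whose letters are all in the same class of $\pi$. Then $$A(X_{\vec u})=\prod_{i=1}^kA(X_{\vec v_i}),$$ the product being taken in the order $i=1,\dots,k$. 2. If $X,Y\in\mathcal A$ are freely independent and $n\ge1$, then $$A^{(n)}(X+Y)=A(X+Y,\dots,X+Y)=\sum_{k=1}^n\ \sum_{\substack{\vec u\in\{1,2,\dots\}^k\\ u(1)+\dots+u(k)=n}}\Bigl[A^{(u(1))}(X)A^{(u(2))}(Y)A^{(u(3))}(X)\cdots+A^{(u(1))}(Y)A^{(u(2))}(X)A^{(u(3))}(Y)\cdots\Bigr],$$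 where each of the two products has $k$ factors, alternating between $X$ and $Y$. 3. Let $\{X(t)\}_{t\ge0}\subset\mathcal A$ be a free Lévy process: $X(0)=0$, the increments over consecutive time intervals are freely independent, and $\varphi((X(s+t)-X(s))^k)=\varphi(X(t)^k)$ for all $s,t,k$. Then for each $n$ the process $t\mapsto A^{(n)}(X(t))$ is a martingale with respect to the filtration induced by the process: with $\mathcal B_s$ the unital subalgebra generated by $\{X(r):r\le s\}$, for all $s\le t$ the conditional expectation of $A^{(n)}(X(t))$ onto $\mathcal B_s$ is $A^{(n)}(X(s))$, that is, $A^{(n)}(X(s))\in\mathcal B_s$ and $\varphi\bigl(b\,A^{(n)}(X(t))\,b'\bigr)=\varphi\bigl(b\,A^{(n)}(X(s))\,b'\bigr)$ for all $b,b'\in\mathcal B_s$. The same holds for any increasing family of unital subalgebras $\mathcal B_s\ni X(s)$ such that $X(t)-X(s)$ is freely independent from $\mathcal B_s$ for all $s\le t$, if $X(0)=0$ and the increments are stationary in the above sense. -/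

import Mathlib

/-!
Free Appell polynomials in a noncommutative probability space `(A, φ)`: `A` is a (possibly
non-commutative) unital algebra over `𝕜 = ℝ` or `ℂ`, and `φ : A →ₗ[𝕜] 𝕜` is a linear functional with
`φ 1 = 1`.  No positivity is assumed.
-/

namespace FreeAppell

section Polynomials

variable {𝕜 : Type*} [RCLike 𝕜]

/-- Polynomials in the non-commuting variables `x_0, x_1, x_2, …`; a monomial is a word in `ℕ`. -/
abbrev NCPoly (𝕜 : Type*) [RCLike 𝕜] : Type _ := MonoidAlgebra 𝕜 (FreeMonoid ℕ)

/-- The monomial `x_{w 0} x_{w 1} ⋯`. -/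
noncomputable def monomial (w : List ℕ) : NCPoly 𝕜 := MonoidAlgebra.single (FreeMonoid.ofList w) 1

/-- `∂_i` of a monomial: the sum over all occurrences of `x_i` of the monomial with that
occurrence omitted. -/
noncomputable def pderivWord (i : ℕ) (w : List ℕ) : NCPoly 𝕜 :=
  ∑ j ∈ Finset.range w.length, if w[j]? = some i then monomial (w.eraseIdx j) else 0

/-- The partial derivative `∂_i`, the linear extension of `pderivWord`. -/
noncomputable def pderiv (i : ℕ) : NCPoly 𝕜 →ₗ[𝕜] NCPoly 𝕜 :=
  Finsupp.linearCombination 𝕜 (fun w : FreeMonoid ℕ => pderivWord i w.toList) ∘ₗ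
    (MonoidAlgebra.coeffLinearEquiv 𝕜).toLinearMap

/-- The substitution `x_i ↦ x_{i + k}`. -/
noncomputable def shift (k : ℕ) : NCPoly 𝕜 →ₐ[𝕜] NCPoly 𝕜 :=
  MonoidAlgebra.mapDomainAlgHom 𝕜 𝕜 (FreeMonoid.map (· + k))

/-- The words in `0, …, n - 1` whose letters appear in the increasing order. -/
def orderedWords (n : ℕ) : Set (FreeMonoid ℕ) :=
  {w | (∀ i ∈ w.toList, i < n) ∧ w.toList.Pairwise (· ≤ ·)}

variable {A : Type*} [Ring A] [Algebra 𝕜 A]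

/-- The value of a polynomial at `x_i = L i` for `i < L.length` (and `x_i = 0` beyond). -/
noncomputable def evalAt (L : List A) : NCPoly 𝕜 →ₐ[𝕜] A :=
  MonoidAlgebra.lift 𝕜 A (FreeMonoid ℕ) (FreeMonoid.lift (fun i => L.getD i 0))

/-- `P` assigns to every tuple `L = [X_0, …, X_{n-1}]` its multivariate free Appell polynomial
`A_{X_0, …, X_{n-1}}(x_0, …, x_{n-1})`: a polynomial in `x_0, …, x_{n-1}`, in each monomial of which
the variables appear in the increasing order of indices, with
`∂_i A_{X_0, …, X_{n-1}} = A_{X_0, …, X_{i-1}}(x_0, …, x_{i-1}) A_{X_{i+1}, …, X_{n-1}}(x_{i+1}, …, x_{n-1})`,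
which is centered for `n > 0`, and with `A_∅ = 1`. -/
structure IsFreeAppell (φ : A →ₗ[𝕜] 𝕜) (P : List A → NCPoly 𝕜) : Prop where
  empty : P [] = 1
  ordered : ∀ L, P L ∈ MonoidAlgebra.supported 𝕜 𝕜 (orderedWords L.length)
  derivative : ∀ L i, i < L.length →
    pderiv i (P L) = P (L.take i) * shift (i + 1) (P (L.drop (i + 1)))
  centered : ∀ L, L ≠ [] → φ (evalAt L (P L)) = 0

/-! ### Existence and uniqueness of the free Appell polynomials -/

theorem linearMap_ext {V : Type*} [AddCommMonoid V] [Module 𝕜 V] {f g : NCPoly 𝕜 →ₗ[𝕜] V}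
    (h : ∀ w : List ℕ, f (monomial w) = g (monomial w)) : f = g := by
  refine LinearMap.ext fun p => ?_
  induction p using MonoidAlgebra.induction_linear with
  | zero => simp
  | add p q hp hq => simp [hp, hq]
  | single w a =>
    have h2 : (MonoidAlgebra.single w a : NCPoly 𝕜) = a • monomial w.toList := by
      simp [monomial]
    rw [h2, map_smul, map_smul, h]

theorem monomial_mul (v w : List ℕ) :
    (monomial v * monomial w : NCPoly 𝕜) = monomial (v ++ w) := by
  simp [monomial, MonoidAlgebra.single_mul_single]

theorem pderiv_monomial (i : ℕ) (w : List ℕ) :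
    pderiv i (monomial w : NCPoly 𝕜) = pderivWord i w := by
  simp [pderiv, monomial, MonoidAlgebra.coeffLinearEquiv]

theorem shift_monomial (k : ℕ) (w : List ℕ) :
    shift k (monomial w : NCPoly 𝕜) = monomial (w.map (· + k)) := by
  simp only [shift, monomial, MonoidAlgebra.mapDomainAlgHom_apply, MonoidAlgebra.mapDomain_single]
  rfl

theorem evalAt_monomial (L : List A) (w : List ℕ) :
    evalAt L (monomial w : NCPoly 𝕜) = (w.map (fun i => L.getD i 0)).prod := by
  simp [evalAt, monomial, MonoidAlgebra.lift_single, FreeMonoid.lift_apply]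

theorem pderiv_var_mul (i a : ℕ) (p : NCPoly 𝕜) :
    pderiv i (monomial [a] * p) = (if a = i then p else 0) + monomial [a] * pderiv i p := by
  have key : (pderiv i ∘ₗ LinearMap.mulLeft 𝕜 (monomial [a]) : NCPoly 𝕜 →ₗ[𝕜] NCPoly 𝕜) =
      (if a = i then LinearMap.id else 0) + LinearMap.mulLeft 𝕜 (monomial [a]) ∘ₗ pderiv i := by
    refine linearMap_ext fun w => ?_
    simp only [LinearMap.comp_apply, LinearMap.mulLeft_apply, LinearMap.add_apply,
      monomial_mul, pderiv_monomial]
    simp only [pderivWord, List.cons_append, List.nil_append, List.length_cons]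
    rw [Finset.sum_range_succ', Finset.mul_sum, add_comm]
    congr 1
    · by_cases h : a = i <;> simp [h]
    · refine Finset.sum_congr rfl fun j _ => ?_
      simp only [List.getElem?_cons_succ, List.eraseIdx_cons_succ]
      split_ifs <;> simp [monomial_mul]
  have := LinearMap.congr_fun key p
  simp only [LinearMap.comp_apply, LinearMap.mulLeft_apply, LinearMap.add_apply] at this
  rw [this]
  split_ifs <;> simp

theorem pderiv_shift_of_lt {i k : ℕ} (h : i < k) (p : NCPoly 𝕜) : pderiv i (shift k p) = 0 := by
  have key : (pderiv i ∘ₗ (shift k).toLinearMap : NCPoly 𝕜 →ₗ[𝕜] NCPoly 𝕜) = 0 := by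
    refine linearMap_ext fun w => ?_
    simp only [LinearMap.comp_apply, AlgHom.toLinearMap_apply, shift_monomial, pderiv_monomial,
      LinearMap.zero_apply, pderivWord]
    refine Finset.sum_eq_zero fun j _ => ?_
    rw [if_neg]
    intro h2
    simp only [List.getElem?_map, Option.map_eq_some_iff] at h2
    obtain ⟨a, _, h3⟩ := h2
    omega
  exact LinearMap.congr_fun key p

theorem pderiv_shift_add (i k : ℕ) (p : NCPoly 𝕜) :
    pderiv (i + k) (shift k p) = shift k (pderiv i p) := by
  have key : (pderiv (i + k) ∘ₗ (shift k).toLinearMap : NCPoly 𝕜 →ₗ[𝕜] NCPoly 𝕜) =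
      (shift k).toLinearMap ∘ₗ pderiv i := by
    refine linearMap_ext fun w => ?_
    simp only [LinearMap.comp_apply, AlgHom.toLinearMap_apply, shift_monomial, pderiv_monomial,
      pderivWord, map_sum, List.length_map]
    refine Finset.sum_congr rfl fun j _ => ?_
    have h3 : ((w.map (· + k))[j]? = some (i + k)) ↔ w[j]? = some i := by
      simp [List.getElem?_map, Option.map_eq_some_iff]
    simp only [h3]
    split_ifs
    · rw [shift_monomial, List.eraseIdx_map]
    · simp
  exact LinearMap.congr_fun key p

theorem shift_shift (j k : ℕ) (p : NCPoly 𝕜) : shift j (shift k p) = shift (k + j) p := by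
  have key : ((shift j).toLinearMap ∘ₗ (shift k).toLinearMap : NCPoly 𝕜 →ₗ[𝕜] NCPoly 𝕜) =
      (shift (k + j)).toLinearMap := by
    refine linearMap_ext fun w => ?_
    simp [shift_monomial, Function.comp_def, add_assoc]
  exact LinearMap.congr_fun key p

theorem evalAt_shift (L : List A) (k : ℕ) (p : NCPoly 𝕜) :
    evalAt L (shift k p) = evalAt (L.drop k) p := by
  have key : ((evalAt L).toLinearMap ∘ₗ (shift k).toLinearMap : NCPoly 𝕜 →ₗ[𝕜] A) =
      (evalAt (L.drop k)).toLinearMap := by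
    refine linearMap_ext fun w => ?_
    simp [shift_monomial, evalAt_monomial, Function.comp_def, List.getD_eq_getElem?_getD,
      List.getElem?_drop, add_comm]
  exact LinearMap.congr_fun key p

theorem supported_induction {S : Set (FreeMonoid ℕ)} {q : NCPoly 𝕜}
    (hq : q ∈ MonoidAlgebra.supported 𝕜 𝕜 S) {V : Type*} [AddCommMonoid V] [Module 𝕜 V]
    (f : NCPoly 𝕜 →ₗ[𝕜] V) (N : Submodule 𝕜 V)
    (h : ∀ w : List ℕ, FreeMonoid.ofList w ∈ S → f (monomial w) ∈ N) : f q ∈ N := by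
  rw [MonoidAlgebra.supported_eq_span_single] at hq
  refine (Submodule.span_le (p := N.comap f)).2 ?_ hq
  rintro _ ⟨w, hw, rfl⟩
  exact h w.toList hw

theorem monomial_mem_supported {S : Set (FreeMonoid ℕ)} {w : List ℕ}
    (h : FreeMonoid.ofList w ∈ S) :
    (monomial w : NCPoly 𝕜) ∈ MonoidAlgebra.supported 𝕜 𝕜 S := by
  rw [MonoidAlgebra.supported_eq_span_single]
  exact Submodule.subset_span ⟨_, h, rfl⟩

theorem shift_mem_supported {m n k : ℕ} (h : m + k ≤ n) {p : NCPoly 𝕜}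
    (hp : p ∈ MonoidAlgebra.supported 𝕜 𝕜 (orderedWords m)) :
    shift k p ∈ MonoidAlgebra.supported 𝕜 𝕜 (orderedWords n) := by
  refine supported_induction hp (shift k).toLinearMap _ fun w hw => ?_
  rw [AlgHom.toLinearMap_apply, shift_monomial]
  refine monomial_mem_supported ⟨?_, ?_⟩
  · intro i hi
    simp only [FreeMonoid.toList_ofList, List.mem_map] at hi
    obtain ⟨a, ha, rfl⟩ := hi
    have := hw.1 a ha
    omega
  · simp only [FreeMonoid.toList_ofList, List.pairwise_map]
    exact hw.2.imp (by intros; omega)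

theorem var_mul_shift_mem_supported {m : ℕ} {p : NCPoly 𝕜}
    (hp : p ∈ MonoidAlgebra.supported 𝕜 𝕜 (orderedWords m)) :
    monomial [0] * shift 1 p ∈ MonoidAlgebra.supported 𝕜 𝕜 (orderedWords (m + 1)) := by
  refine supported_induction hp (LinearMap.mulLeft 𝕜 (monomial [0]) ∘ₗ (shift 1).toLinearMap)
    _ fun w hw => ?_
  rw [LinearMap.comp_apply, AlgHom.toLinearMap_apply, shift_monomial, LinearMap.mulLeft_apply,
    monomial_mul]
  refine monomial_mem_supported ⟨?_, ?_⟩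
  · intro i hi
    simp only [FreeMonoid.toList_ofList, List.mem_append, List.mem_map, List.mem_singleton] at hi
    rcases hi with rfl | ⟨a, ha, rfl⟩
    · omega
    · have := hw.1 a ha
      omega
  · simp only [FreeMonoid.toList_ofList, List.singleton_append, List.pairwise_cons,
      List.pairwise_map]
    exact ⟨fun _ _ => Nat.zero_le _, hw.2.imp (by intros; omega)⟩

/-- A solution of `IsFreeAppell`, by recursion on the length. -/
noncomputable def solution (φ : A →ₗ[𝕜] 𝕜) : List A → NCPoly 𝕜
  | [] => 1
  | X :: L => monomial [0] * shift 1 (solution φ L) -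
      ∑ k : Fin (L.length + 1), φ (X * evalAt (L.take k) (solution φ (L.take k))) •
        shift (k + 1) (solution φ (L.drop k))
  termination_by L => L.length
  decreasing_by all_goals simp

theorem solution_nil (φ : A →ₗ[𝕜] 𝕜) : solution φ [] = 1 := by
  rw [solution]

theorem solution_cons (φ : A →ₗ[𝕜] 𝕜) (X : A) (L : List A) :
    solution φ (X :: L) = monomial [0] * shift 1 (solution φ L) -
      ∑ k ∈ Finset.range (L.length + 1), φ (X * evalAt (L.take k) (solution φ (L.take k))) •
        shift (k + 1) (solution φ (L.drop k)) := by
  rw [solution, Finset.sum_range]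

theorem solution_ordered (φ : A →ₗ[𝕜] 𝕜) : ∀ (n : ℕ) (L : List A), L.length = n →
    solution φ L ∈ MonoidAlgebra.supported 𝕜 𝕜 (orderedWords L.length) := by
  intro n
  induction n using Nat.strong_induction_on with
  | _ n ih =>
    rintro (_ | ⟨X, L⟩) hn
    · rw [solution_nil]
      exact monomial_mem_supported (w := []) ⟨by simp, by simp⟩
    · rw [solution_cons]
      simp only [List.length_cons] at hn ⊢
      refine Submodule.sub_mem _ (var_mul_shift_mem_supported (ih _ (by omega) L rfl)) ?_
      refine Submodule.sum_mem _ fun k hk => Submodule.smul_mem _ _ ?_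
      rw [Finset.mem_range] at hk
      refine shift_mem_supported ?_ (ih _ ?_ (L.drop k) rfl) <;> rw [List.length_drop] <;> omega

theorem pderiv_solution (φ : A →ₗ[𝕜] 𝕜) : ∀ (n : ℕ) (L : List A), L.length = n →
    ∀ i, i < L.length → pderiv i (solution φ L) =
      solution φ (L.take i) * shift (i + 1) (solution φ (L.drop (i + 1))) := by
  intro n
  induction n using Nat.strong_induction_on with
  | _ n ih =>
    rintro (_ | ⟨X, L⟩) hn i hi
    · simp at hi
    · rw [solution_cons, map_sub, map_sum, pderiv_var_mul]
      simp only [List.length_cons] at hn hi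
      rcases i with _ | i
      · rw [pderiv_shift_of_lt (by omega)]
        have : ∀ k ∈ Finset.range (L.length + 1),
            pderiv 0 (φ (X * evalAt (L.take k) (solution φ (L.take k))) •
              shift (k + 1) (solution φ (L.drop k))) = 0 := by
          intro k _
          rw [map_smul, pderiv_shift_of_lt (by omega), smul_zero]
        rw [Finset.sum_eq_zero this]
        simp [solution_nil]
      · rw [pderiv_shift_add, ih _ (by omega) L rfl i (by omega)]
        simp only [List.take_succ_cons, List.drop_succ_cons]
        rw [solution_cons, if_neg (by omega), zero_add, sub_mul, map_mul, shift_shift, mul_assoc,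
          add_assoc i 1 1]
        congr 1
        rw [Finset.sum_mul]
        have hlen : (L.take i).length = i := by rw [List.length_take]; omega
        rw [hlen]
        symm
        refine Finset.sum_subset_zero_on_sdiff ?_ ?_ ?_
        · intro k hk
          rw [Finset.mem_range] at *
          omega
        · intro k hk
          rw [Finset.mem_sdiff, Finset.mem_range, Finset.mem_range] at hk
          rw [map_smul, pderiv_shift_of_lt (by omega), smul_zero]
        · intro k hk
          rw [Finset.mem_range] at hk
          rw [map_smul, smul_mul_assoc]
          have h1 : (L.take i).take k = L.take k := by rw [List.take_take]; congr 1; omega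
          have h2 : i + 1 = (i - k) + (k + 1) := by omega
          have h3 : (L.drop k).drop (i - k + 1) = L.drop (i + 1) := by
            rw [List.drop_drop]; congr 1; omega
          have h4 : (L.drop k).take (i - k) = (L.take i).drop k := by
            rw [List.drop_take]
          rw [h1]
          conv_rhs => rw [h2, pderiv_shift_add,
            ih _ (by rw [List.length_drop]; omega) (L.drop k) rfl (i - k)
              (by rw [List.length_drop]; omega)]
          rw [map_mul (shift (k + 1)), shift_shift, h3, h4]
          congr 4
          omega

theorem solution_centered (φ : A →ₗ[𝕜] 𝕜) (hφ : φ 1 = 1) : ∀ (n : ℕ) (L : List A), L.length = n →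
    L ≠ [] → φ (evalAt L (solution φ L)) = 0 := by
  intro n
  induction n using Nat.strong_induction_on with
  | _ n ih =>
    rintro (_ | ⟨X, L⟩) hn hne
    · exact absurd rfl hne
    · simp only [List.length_cons] at hn
      rw [solution_cons, map_sub, map_mul (evalAt (X :: L)), map_sum, map_sub, map_sum,
        Finset.sum_range_succ]
      have h1 : ∀ k ∈ Finset.range L.length,
          φ (evalAt (X :: L) (φ (X * evalAt (L.take k) (solution φ (L.take k))) •
            shift (k + 1) (solution φ (L.drop k)))) = 0 := by
        intro k hk
        rw [Finset.mem_range] at hk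
        rw [map_smul, map_smul, evalAt_shift, List.drop_succ_cons,
          ih _ (by rw [List.length_drop]; omega) (L.drop k) rfl, smul_zero]
        rw [ne_eq, List.drop_eq_nil_iff]
        omega
      rw [Finset.sum_eq_zero h1, map_smul, map_smul, evalAt_shift, evalAt_shift, evalAt_monomial]
      simp [solution_nil, hφ]

theorem isFreeAppell_solution (φ : A →ₗ[𝕜] 𝕜) (hφ : φ 1 = 1) : IsFreeAppell φ (solution φ) where
  empty := solution_nil φ
  ordered L := solution_ordered φ _ L rfl
  derivative L := pderiv_solution φ _ L rfl
  centered L := solution_centered φ hφ _ L rfl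

theorem coeff_eq_zero_of_pderiv {n : ℕ} {D : NCPoly 𝕜}
    (hD : D ∈ MonoidAlgebra.supported 𝕜 𝕜 (orderedWords n))
    (h : ∀ i < n, pderiv i D = 0) (w : List ℕ) (hw : w ≠ []) :
    D.coeff (FreeMonoid.ofList w) = 0 := by
  have hsupp : ∀ v : FreeMonoid ℕ, D.coeff v ≠ 0 → v ∈ orderedWords n := by
    intro v hv
    exact hD (Finsupp.mem_support_iff.2 hv)
  by_contra hne
  obtain ⟨i, w, rfl⟩ := List.exists_cons_of_ne_nil hw
  have hmem := hsupp _ hne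
  have hi : i < n := hmem.1 i (by simp)
  have hc : (pderiv i D).coeff (FreeMonoid.ofList w) = 0 := by rw [h i hi]; rfl
  have hexp : (pderiv i D).coeff (FreeMonoid.ofList w) =
      D.coeff.sum fun v a => a * (pderivWord i v.toList : NCPoly 𝕜).coeff (FreeMonoid.ofList w) := by
    simp only [pderiv, LinearMap.comp_apply, Finsupp.linearCombination_apply]
    rw [Finsupp.sum, MonoidAlgebra.coeff_sum, Finsupp.finsetSum_apply]
    rfl
  have hword : ∀ v : FreeMonoid ℕ,
      (pderivWord i v.toList : NCPoly 𝕜).coeff (FreeMonoid.ofList w) =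
        (((Finset.range v.toList.length).filter
          (fun j => v.toList[j]? = some i ∧ v.toList.eraseIdx j = w)).card : 𝕜) := by
    intro v
    rw [pderivWord, MonoidAlgebra.coeff_sum, Finsupp.finsetSum_apply, Finset.card_filter,
      Nat.cast_sum]
    refine Finset.sum_congr rfl fun j _ => ?_
    by_cases h1 : v.toList[j]? = some i
    · by_cases h2 : v.toList.eraseIdx j = w
      · simp [h1, h2, monomial]
      · have h3 : FreeMonoid.ofList (v.toList.eraseIdx j) ≠ FreeMonoid.ofList w :=
          fun h => h2 (FreeMonoid.ofList.injective h)
        simp [h1, h2, monomial]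
    · simp [h1]
  rw [hexp, Finsupp.sum, Finset.sum_eq_single (FreeMonoid.ofList (i :: w))] at hc
  · rw [hword] at hc
    rcases mul_eq_zero.1 hc with h1 | h1
    · exact hne h1
    · rw [Nat.cast_eq_zero, Finset.card_eq_zero, Finset.filter_eq_empty_iff] at h1
      exact h1 (x := 0) (by simp) (by simp)
  · intro v hv hvne
    rw [hword]
    refine mul_eq_zero_of_right _ ?_
    rw [Nat.cast_eq_zero, Finset.card_eq_zero, Finset.filter_eq_empty_iff]
    rintro j hj ⟨h1, h2⟩
    apply hvne
    rw [Finset.mem_range] at hj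
    have hperm : (i :: w).Perm v.toList := by
      rw [List.getElem?_eq_getElem hj, Option.some_inj] at h1
      rw [← h2, ← h1]
      exact List.getElem_cons_eraseIdx_perm hj
    have h5 := (hsupp v (Finsupp.mem_support_iff.1 hv)).2
    have h6 : (i :: w).Pairwise (· ≤ ·) := hmem.2
    exact (congrArg FreeMonoid.ofList (hperm.eq_of_pairwise
      (fun a b _ _ h7 h8 => le_antisymm h7 h8) h6 h5)).symm
  · intro h1
    rw [Finsupp.notMem_support_iff.1 h1, zero_mul]

theorem isFreeAppell_unique (φ : A →ₗ[𝕜] 𝕜) (hφ : φ 1 = 1) {P Q : List A → NCPoly 𝕜}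
    (hP : IsFreeAppell φ P) (hQ : IsFreeAppell φ Q) : P = Q := by
  have key : ∀ (n : ℕ) (L : List A), L.length = n → P L = Q L := by
    intro n
    induction n using Nat.strong_induction_on with
    | _ n ih =>
      intro L hn
      by_cases hL : L = []
      · rw [hL, hP.empty, hQ.empty]
      have hco := coeff_eq_zero_of_pderiv (Submodule.sub_mem _ (hP.ordered L) (hQ.ordered L))
        (fun i hi => by
          rw [map_sub, hP.derivative L i hi, hQ.derivative L i hi,
            ih _ (by rw [List.length_take]; omega) (L.take i) rfl,
            ih _ (by rw [List.length_drop]; omega) (L.drop (i + 1)) rfl, sub_self])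
      have hD : P L - Q L = ((P L - Q L).coeff 1) • (1 : NCPoly 𝕜) := by
        ext w
        by_cases hw : w.toList = []
        · obtain rfl : w = 1 := FreeMonoid.toList.injective hw
          simp [MonoidAlgebra.one_def]
        · have h1 := hco w.toList hw
          rw [FreeMonoid.ofList_toList] at h1
          have h2 : (1 : FreeMonoid ℕ) ≠ w := by rintro rfl; exact hw rfl
          rw [h1]
          simp [MonoidAlgebra.one_def, h2]
      have h0 : φ (evalAt L (P L - Q L)) = 0 := by
        rw [map_sub, map_sub, hP.centered L hL, hQ.centered L hL, sub_zero]
      rw [hD, map_smul, map_one (evalAt L), map_smul, hφ, smul_eq_mul, mul_one] at h0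
      rw [h0, zero_smul] at hD
      exact sub_eq_zero.1 hD
  funext L
  exact key _ L rfl

/-- The conditions determine the multivariate free Appell polynomials. -/
theorem existsUnique_isFreeAppell (φ : A →ₗ[𝕜] 𝕜) (hφ : φ 1 = 1) :
    ∃! P : List A → NCPoly 𝕜, IsFreeAppell φ P :=
  ⟨solution φ, isFreeAppell_solution φ hφ,
    fun _ hP => isFreeAppell_unique φ hφ hP (isFreeAppell_solution φ hφ)⟩

/-- The multivariate free Appell polynomials `A_{X_0, …, X_{n-1}}(x_0, …, x_{n-1})` for the
functional `φ`: the unique family with `IsFreeAppell φ` (if `φ 1 = 1`). -/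
noncomputable def freeAppellPoly (φ : A →ₗ[𝕜] 𝕜) : List A → NCPoly 𝕜 :=
  Classical.epsilon (IsFreeAppell φ)

theorem isFreeAppell_freeAppellPoly (φ : A →ₗ[𝕜] 𝕜) (hφ : φ 1 = 1) :
    IsFreeAppell φ (freeAppellPoly φ) :=
  Classical.epsilon_spec (existsUnique_isFreeAppell φ hφ).exists

/-- `A(X_0, …, X_{n-1}) = A_{X_0, …, X_{n-1}}(X_0, …, X_{n-1})`, an element of the algebra. -/
noncomputable def appell (φ : A →ₗ[𝕜] 𝕜) (L : List A) : A := evalAt L (freeAppellPoly φ L)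

end Polynomials

/-! ### Free Appell polynomials in one variable -/

section OneVariable

open PowerSeries

variable {𝕜 : Type*} [RCLike 𝕜]

/-- `R` is the free cumulant generating function `∑_{n ≥ 1} r_n z ^ n` of the moment sequence `m`:
with `G(w) = ∑_{n ≥ 0} m_n w ^ (-(n + 1))` it satisfies `(1 + R(G(w))) / G(w) = w`.  In `z = 1 / w`,
where `G = z M(z)` and `M(z) = ∑_{n ≥ 0} m_n z ^ n`, this reads `1 + R(z M(z)) = M(z)`. -/
def IsFreeCumulantSeries (m : ℕ → 𝕜) (R : 𝕜⟦X⟧) : Prop :=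
  constantCoeff R = 0 ∧ 1 + R.subst (X * PowerSeries.mk m) = PowerSeries.mk m

theorem coeff_subst_eq_sum (m : ℕ → 𝕜) (R : 𝕜⟦X⟧) (n : ℕ) :
    coeff n (R.subst (X * PowerSeries.mk m)) =
      ∑ s ∈ Finset.range (n + 1), coeff s R * coeff n ((X * PowerSeries.mk m) ^ s) := by
  have hs : HasSubst (X * PowerSeries.mk m) := HasSubst.of_constantCoeff_zero' (by simp)
  rw [coeff_subst' hs, finsum_eq_sum_of_support_subset]
  · simp only [smul_eq_mul]
    rfl
  · intro s hsne
    rw [Function.mem_support] at hsne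
    simp only [Finset.coe_range, Set.mem_Iio]
    by_contra hlt
    apply hsne
    rw [mul_pow, coeff_X_pow_mul', if_neg (by omega), smul_zero]

theorem coeff_self_pow (m : ℕ → 𝕜) (h0 : m 0 = 1) (n : ℕ) :
    coeff n ((X * PowerSeries.mk m) ^ n) = 1 := by
  rw [mul_pow, coeff_X_pow_mul', if_pos le_rfl, Nat.sub_self, coeff_zero_eq_constantCoeff,
    map_pow, ← coeff_zero_eq_constantCoeff_apply, coeff_mk, h0, one_pow]

/-- A solution of `IsFreeCumulantSeries`, by recursion. -/
noncomputable def cumulantSolution (m : ℕ → 𝕜) : ℕ → 𝕜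
  | 0 => 0
  | n + 1 => m (n + 1) - ∑ s : Fin (n + 1),
      cumulantSolution m s * coeff (n + 1) ((X * PowerSeries.mk m) ^ (s : ℕ))
  termination_by n => n

theorem existsUnique_isFreeCumulantSeries (m : ℕ → 𝕜) (h0 : m 0 = 1) :
    ∃! R : 𝕜⟦X⟧, IsFreeCumulantSeries m R := by
  refine ⟨PowerSeries.mk (cumulantSolution m), ⟨?_, ?_⟩, ?_⟩
  · rw [← coeff_zero_eq_constantCoeff_apply, coeff_mk, cumulantSolution]
  · ext n
    rw [map_add, coeff_subst_eq_sum, coeff_mk, Finset.sum_range_succ, coeff_self_pow m h0, mul_one,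
      coeff_mk]
    rcases n with _ | n
    · simp [cumulantSolution, h0]
    · have h1 : cumulantSolution m (n + 1) = m (n + 1) - ∑ s : Fin (n + 1),
          cumulantSolution m s * coeff (n + 1) ((X * PowerSeries.mk m) ^ (s : ℕ)) := by
        rw [cumulantSolution]
      rw [h1, Finset.sum_range]
      simp [coeff_one]
  · rintro R ⟨hR0, hR⟩
    ext n
    induction n using Nat.strong_induction_on with
    | _ n ih =>
      rcases n with _ | n
      · rw [coeff_zero_eq_constantCoeff_apply, hR0, coeff_mk, cumulantSolution]
      · have h1 : cumulantSolution m (n + 1) = m (n + 1) - ∑ s : Fin (n + 1),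
            cumulantSolution m s * coeff (n + 1) ((X * PowerSeries.mk m) ^ (s : ℕ)) := by
          rw [cumulantSolution]
        have h2 := congrArg (coeff (n + 1)) hR
        rw [map_add, coeff_subst_eq_sum, coeff_mk, Finset.sum_range_succ, coeff_self_pow m h0,
          mul_one] at h2
        have h3 : coeff (n + 1) (1 : 𝕜⟦X⟧) = 0 := by simp [coeff_one]
        rw [h3, zero_add] at h2
        rw [coeff_mk, h1, ← h2, ← Finset.sum_range
          (fun s => cumulantSolution m s * coeff (n + 1) ((X * PowerSeries.mk m) ^ s)),
          Finset.sum_congr rfl (fun s hs => by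
            rw [ih s (Finset.mem_range.1 hs), coeff_mk] :
            ∀ s ∈ Finset.range (n + 1), coeff s R * coeff (n + 1) ((X * PowerSeries.mk m) ^ s) =
              cumulantSolution m s * coeff (n + 1) ((X * PowerSeries.mk m) ^ s))]
        ring

/-- The free cumulant generating function `R(z) = ∑_{n ≥ 1} r_n z ^ n` of a moment sequence `m`
(with `m 0 = 1`). -/
noncomputable def freeCumulantSeries (m : ℕ → 𝕜) : 𝕜⟦X⟧ := Classical.epsilon (IsFreeCumulantSeries m)

theorem isFreeCumulantSeries_freeCumulantSeries (m : ℕ → 𝕜) (h0 : m 0 = 1) :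
    IsFreeCumulantSeries m (freeCumulantSeries m) :=
  Classical.epsilon_spec (existsUnique_isFreeCumulantSeries m h0).exists

/-- The one-variable free Appell polynomials `A^{(n)}(x)` of a moment sequence `m`:
`∑_{n ≥ 0} A^{(n)}(x) z ^ n = 1 / (1 - x z + R(z))`, as power series in `z` over `𝕜[x]`. -/
noncomputable def appellPolynomial (m : ℕ → 𝕜) (n : ℕ) : Polynomial 𝕜 :=
  coeff n (invOfUnit
    (1 - C Polynomial.X * X + PowerSeries.map Polynomial.C (freeCumulantSeries m)) 1)

variable {A : Type*} [Ring A] [Algebra 𝕜 A]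

/-- `A^{(n)}(X)`: the one-variable free Appell polynomial of the moment sequence `φ (X ^ k)` of `X`,
evaluated at `X` itself. -/
noncomputable def appellOne (φ : A →ₗ[𝕜] 𝕜) (n : ℕ) (X : A) : A :=
  Polynomial.aeval X (appellPolynomial (fun k => φ (X ^ k)) n)

end OneVariable

/-! ### Freeness, blocks, free Lévy processes and martingales -/

section Freeness

variable {𝕜 : Type*} [RCLike 𝕜] {A : Type*} [Ring A] [Algebra 𝕜 A]

/-- A family of unital subalgebras is freely independent: every alternating product of centered
elements is centered. -/
def FreelyIndependent (φ : A →ₗ[𝕜] 𝕜) {κ : Type*} (B : κ → Subalgebra 𝕜 A) : Prop :=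
  ∀ L : List (κ × A), L ≠ [] → L.IsChain (fun p q => p.1 ≠ q.1) →
    (∀ p ∈ L, p.2 ∈ B p.1 ∧ φ p.2 = 0) → φ (L.map Prod.snd).prod = 0

/-- Families of random variables are freely independent if the unital subalgebras which they
generate are. -/
def FreelyIndependentSets (φ : A →ₗ[𝕜] 𝕜) {κ : Type*} (S : κ → Set A) : Prop :=
  FreelyIndependent φ fun k => Algebra.adjoin 𝕜 (S k)

open scoped Classical in
/-- The factors `v_1, …, v_k` of the word `u = (v_1, …, v_k)`: its longest consecutive pieces whose
letters are all in the same class of the partition `π`. -/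
noncomputable def classBlocks {ι : Type*} (π : Setoid ι) (u : List ι) : List (List ι) :=
  u.splitBy fun i j => decide (π i j)

/-- For `u = (u_1, u_2, …)`, the product `f u_1 * g u_2 * f u_3 * ⋯`. -/
def altProd (f g : ℕ → A) : List ℕ → A
  | [] => 1
  | a :: u => f a * altProd g f u

open scoped NNReal

/-- A free Lévy process: it starts at `0`, and has freely independent, stationary increments. -/
structure IsFreeLevyProcess (φ : A →ₗ[𝕜] 𝕜) (X : ℝ≥0 → A) : Prop where
  zero : X 0 = 0
  free_increments : ∀ (n : ℕ) (t : Fin (n + 1) → ℝ≥0), Monotone t →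
    FreelyIndependentSets φ (fun i : Fin n => {X (t i.succ) - X (t i.castSucc)})
  stationary : ∀ s t k, φ ((X (s + t) - X s) ^ k) = φ (X t ^ k)

/-- A free Lévy process relative to a filtration `B` of the algebra: an adapted process which starts
at `0`, with stationary increments which are freely independent from the past. -/
structure IsFreeLevyProcessFor (φ : A →ₗ[𝕜] 𝕜) (B : ℝ≥0 → Subalgebra 𝕜 A) (X : ℝ≥0 → A) :
    Prop where
  zero : X 0 = 0
  mono : Monotone B
  adapted : ∀ t, X t ∈ B t
  free_increments : ∀ s t, s ≤ t →
    FreelyIndependent φ ![B s, Algebra.adjoin 𝕜 {X t - X s}]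
  stationary : ∀ s t k, φ ((X (s + t) - X s) ^ k) = φ (X t ^ k)

/-- The filtration induced by a process. -/
def inducedFiltration (𝕜 : Type*) [RCLike 𝕜] {A : Type*} [Ring A] [Algebra 𝕜 A] (X : ℝ≥0 → A)
    (t : ℝ≥0) : Subalgebra 𝕜 A :=
  Algebra.adjoin 𝕜 (X '' Set.Iic t)

/-- `c` is a conditional expectation of `a` onto the subalgebra `B`: it is in `B`, and
`φ (b a b') = φ (b c b')` for all `b, b'` in `B`. -/
def IsCondExp (φ : A →ₗ[𝕜] 𝕜) (B : Subalgebra 𝕜 A) (a c : A) : Prop :=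
  c ∈ B ∧ ∀ b ∈ B, ∀ b' ∈ B, φ (b * a * b') = φ (b * c * b')

/-- `Z` is a martingale with respect to the filtration `B`: for `s ≤ t`, the conditional expectation
of `Z t` onto `B s` is `Z s`. -/
def IsMartingale (φ : A →ₗ[𝕜] 𝕜) (B : ℝ≥0 → Subalgebra 𝕜 A) (Z : ℝ≥0 → A) : Prop :=
  ∀ s t, s ≤ t → IsCondExp φ (B s) (Z t) (Z s)

end Freeness

end FreeAppell

/-! Two facts carry the whole proof. The first is the recursion `appell_cons`: A(X, L) is X A(L)
minus the sum over k of φ(X A(first k letters of L)) A(remaining letters of L), where the numbers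
φ(X A(...)) play the role of free cumulants. The second is freeness in the form of reduced words: a
nonempty product of centered letters, neighbours taken from different algebras, is centered, and
stays so when multiplied on the left by any element of an algebra other than that of its first
letter (`apply_mul_reduced`).

Factorization (`appell_append`) is an induction on the length. Shorter Appell polynomials are
already products over runs of one label, hence products of reduced words. So a cumulant φ(x A(w))
vanishes as soon as some letter of w has a label different from that of x, and in the recursion for
a word cut at a change of label only the terms that keep the right part intact survive.

For the binomial formula, work with power series over A. A series c with c(0) = 0 for which (1 - Zz
+ c(z))⁻¹ is centered in all positive degrees must be the free cumulant series of Z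
(`eq_freeCumulantSeries`), so such a resolvent is the Appell generating function. This identifies
A^(n)(Z) with A(Z, ..., Z). It also reduces the formula for X + Y to checking that the series of
alternating products inverts 1 - (X + Y)z + R_X + R_Y and is centered (`appellSeries_add`).

For the martingale property, apply the binomial formula to X(t) = X(s) + (X(t) - X(s)). Among the
alternating products only A^(n)(X(s)) has a nonzero conditional expectation: any other one is a
nonempty reduced word starting in the algebra of the increment, possibly preceded by a factor from
the past. For the induced filtration, freeness of an increment from the past follows from freeness
of finitely many consecutive increments by grouping (`FreelyIndependent.group`). -/

namespace FreeAppell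

/-! ### Reduced words -/

section Words

variable {𝕜 : Type*} [RCLike 𝕜] {A : Type*} [Ring A] [Algebra 𝕜 A] {κ : Type*}

/-- A word of centered elements of the subalgebras `B k`, neighbouring letters being taken from
different ones. -/
def IsReduced (φ : A →ₗ[𝕜] 𝕜) (B : κ → Subalgebra 𝕜 A) (L : List (κ × A)) : Prop :=
  L.IsChain (fun p q => p.1 ≠ q.1) ∧ ∀ p ∈ L, p.2 ∈ B p.1 ∧ φ p.2 = 0

variable {φ : A →ₗ[𝕜] 𝕜} {B : κ → Subalgebra 𝕜 A}

theorem isReduced_nil : IsReduced φ B [] := ⟨List.isChain_nil, by simp⟩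

theorem isReduced_cons {p : κ × A} {L : List (κ × A)} :
    IsReduced φ B (p :: L) ↔
      (p.2 ∈ B p.1 ∧ φ p.2 = 0) ∧ (∀ q ∈ L.head?, p.1 ≠ q.1) ∧ IsReduced φ B L := by
  simp only [IsReduced, List.isChain_cons, List.forall_mem_cons]
  tauto

theorem isReduced_append {L M : List (κ × A)} :
    IsReduced φ B (L ++ M) ↔ IsReduced φ B L ∧ IsReduced φ B M ∧
      ∀ p ∈ L.getLast?, ∀ q ∈ M.head?, p.1 ≠ q.1 := by
  simp only [IsReduced, List.isChain_append, List.forall_mem_append]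
  tauto

theorem IsReduced.apply_prod_eq_zero {L : List (κ × A)} (hL : IsReduced φ B L)
    (hB : FreelyIndependent φ B) (hne : L ≠ []) : φ (L.map Prod.snd).prod = 0 :=
  hB L hne hL.1 hL.2

theorem apply_sub_algebraMap (hφ : φ 1 = 1) (a : A) : φ (a - algebraMap 𝕜 A (φ a)) = 0 := by
  rw [map_sub, Algebra.algebraMap_eq_smul_one, map_smul, hφ, smul_eq_mul, mul_one, sub_self]

theorem apply_algebraMap_mul (c : 𝕜) (a : A) : φ (algebraMap 𝕜 A c * a) = c * φ a := by
  rw [← Algebra.smul_def, map_smul, smul_eq_mul]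

theorem apply_mul_algebraMap (c : 𝕜) (a : A) : φ (a * algebraMap 𝕜 A c) = c * φ a := by
  rw [← Algebra.commutes, apply_algebraMap_mul]

/-- Split a into its centered part and a scalar: the first extends the reduced word by one letter,
the second leaves a multiple of a centered word. -/
theorem apply_mul_reduced (hφ : φ 1 = 1) (hB : FreelyIndependent φ B) {k : κ} {a : A}
    (ha : a ∈ B k) {L : List (κ × A)} (hL : IsReduced φ B L) (hne : L ≠ [])
    (hk : ∀ q ∈ L.head?, k ≠ q.1) : φ (a * (L.map Prod.snd).prod) = 0 := by
  have h1 : IsReduced φ B ((k, a - algebraMap 𝕜 A (φ a)) :: L) :=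
    isReduced_cons.2 ⟨⟨Subalgebra.sub_mem _ ha (Subalgebra.algebraMap_mem _ _),
      apply_sub_algebraMap hφ a⟩, hk, hL⟩
  have h2 := h1.apply_prod_eq_zero hB (by simp)
  rw [List.map_cons, List.prod_cons, sub_mul, map_sub, apply_algebraMap_mul,
    hL.apply_prod_eq_zero hB hne, mul_zero, sub_zero] at h2
  exact h2

theorem exists_eq_append_label {α : Type*} (k : κ) (u : List (κ × α)) :
    ∃ v w, u = v ++ w ∧ (∀ p ∈ v, p.1 = k) ∧ ∀ q ∈ w.head?, k ≠ q.1 := by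
  induction u with
  | nil => exact ⟨[], [], by simp⟩
  | cons p u ih =>
    by_cases h : p.1 = k
    · obtain ⟨v, w, rfl, hv, hw⟩ := ih
      exact ⟨p :: v, w, rfl, by simpa [h] using hv, hw⟩
    · exact ⟨[], p :: u, rfl, by simp, by simpa using Ne.symm h⟩

end Words

/-! ### Recursion and factorization of the multivariate Appell polynomials -/

section Multivariate

variable {𝕜 : Type*} [RCLike 𝕜] {A : Type*} [Ring A] [Algebra 𝕜 A] {κ : Type*}
  {φ : A →ₗ[𝕜] 𝕜} {B : κ → Subalgebra 𝕜 A}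

theorem freeAppellPoly_eq_solution (hφ : φ 1 = 1) : freeAppellPoly φ = solution φ :=
  isFreeAppell_unique φ hφ (isFreeAppell_freeAppellPoly φ hφ) (isFreeAppell_solution φ hφ)

theorem appell_nil (hφ : φ 1 = 1) : appell φ [] = 1 := by
  rw [appell, freeAppellPoly_eq_solution hφ, solution_nil, map_one]

theorem appell_cons (hφ : φ 1 = 1) (X : A) (L : List A) :
    appell φ (X :: L) = X * appell φ L -
      ∑ k ∈ Finset.range (L.length + 1), φ (X * appell φ (L.take k)) • appell φ (L.drop k) := by
  simp only [appell, freeAppellPoly_eq_solution hφ]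
  rw [solution_cons, map_sub, map_mul, evalAt_shift, evalAt_monomial, map_sum]
  simp only [map_smul, evalAt_shift]
  simp

theorem apply_appell (hφ : φ 1 = 1) {L : List A} (hL : L ≠ []) : φ (appell φ L) = 0 :=
  (isFreeAppell_freeAppellPoly φ hφ).centered L hL

theorem appell_mem (hφ : φ 1 = 1) {S : Subalgebra 𝕜 A} : ∀ (n : ℕ) (L : List A), L.length = n →
    (∀ a ∈ L, a ∈ S) → appell φ L ∈ S := by
  intro n
  induction n using Nat.strong_induction_on with
  | _ n ih =>
    rintro (_ | ⟨X, L⟩) hn hL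
    · rw [appell_nil hφ]; exact S.one_mem
    · simp only [List.length_cons] at hn
      rw [appell_cons hφ]
      refine S.sub_mem (S.mul_mem (hL _ (by simp)) (ih _ (by omega) L rfl
        fun a ha => hL a (by simp [ha]))) (S.sum_mem fun k _ => S.smul_mem ?_ _)
      exact ih _ (by rw [List.length_drop]; omega) _ rfl
        fun a ha => hL a (List.mem_cons_of_mem _ (List.mem_of_mem_drop ha))

/-- If the Appell polynomials of shorter words factor at changes of the label, then they are
products of reduced words. -/
theorem exists_reduced_appell (hφ : φ 1 = 1) {N : ℕ}
    (H : ∀ u v : List (κ × A), (u ++ v).length < N → (∀ p ∈ u ++ v, p.2 ∈ B p.1) →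
      (∀ p ∈ u.getLast?, ∀ q ∈ v.head?, p.1 ≠ q.1) →
      appell φ ((u ++ v).map Prod.snd) = appell φ (u.map Prod.snd) * appell φ (v.map Prod.snd)) :
    ∀ (n : ℕ) (u : List (κ × A)), u.length = n → n < N → u ≠ [] → (∀ p ∈ u, p.2 ∈ B p.1) →
      ∃ L : List (κ × A), IsReduced φ B L ∧ L ≠ [] ∧
        (∀ p ∈ u.head?, ∀ q ∈ L.head?, q.1 = p.1) ∧
        appell φ (u.map Prod.snd) = (L.map Prod.snd).prod := by
  intro n
  induction n using Nat.strong_induction_on with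
  | _ n ih =>
    rintro (_ | ⟨p, u⟩) hn hN hne hu
    · exact absurd rfl hne
    -- The maximal initial run p, v of one label contributes a single centered letter; the induction
    -- treats the rest w, which starts with another label.
    obtain ⟨v, w, rfl, hv, hw⟩ := exists_eq_append_label p.1 u
    have hlast : ∀ q ∈ (p :: v).getLast?, q.1 = p.1 := by
      intro q hq
      have := List.mem_of_mem_getLast? hq
      rcases List.mem_cons.1 this with rfl | h
      · rfl
      · exact hv _ h
    have hmem : appell φ ((p :: v).map Prod.snd) ∈ B p.1 := by
      refine appell_mem hφ _ _ rfl fun a ha => ?_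
      obtain ⟨q, hq, rfl⟩ := List.mem_map.1 ha
      have h1 := hu q (by rw [← List.cons_append]; exact List.mem_append_left _ hq)
      rcases List.mem_cons.1 hq with rfl | h
      · exact h1
      · rwa [hv _ h] at h1
    have hc : φ (appell φ ((p :: v).map Prod.snd)) = 0 := apply_appell hφ (by simp)
    rcases eq_or_ne w [] with rfl | hwne
    · refine ⟨[(p.1, appell φ ((p :: v).map Prod.snd))],
        isReduced_cons.2 ⟨⟨hmem, hc⟩, by simp, isReduced_nil⟩, by simp, by simp, by simp⟩
    · obtain ⟨L, hL, hLne, hLh, hLe⟩ := ih w.length (by simp at hn; omega) w rfl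
        (by simp at hn; omega) hwne
        (fun q hq => hu q (List.mem_cons_of_mem _ (List.mem_append_right _ hq)))
      refine ⟨(p.1, appell φ ((p :: v).map Prod.snd)) :: L,
        isReduced_cons.2 ⟨⟨hmem, hc⟩, ?_, hL⟩, by simp, by simp, ?_⟩
      · intro q hq
        obtain ⟨q', w', rfl⟩ := List.exists_cons_of_ne_nil hwne
        rw [hLh q' (by simp) q hq]
        exact hw q' (by simp)
      · rw [← List.cons_append, H (p :: v) w (by rw [List.cons_append]; omega) hu ?_, hLe]
        · simp
        · intro q hq q' hq'
          rw [hlast q hq]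
          exact hw q' hq'

/-- The Appell polynomials factor at changes of the label. -/
theorem appell_append (hφ : φ 1 = 1) (hB : FreelyIndependent φ B) :
    ∀ (n : ℕ) (u v : List (κ × A)), (u ++ v).length = n → (∀ p ∈ u ++ v, p.2 ∈ B p.1) →
      (∀ p ∈ u.getLast?, ∀ q ∈ v.head?, p.1 ≠ q.1) →
      appell φ ((u ++ v).map Prod.snd) =
        appell φ (u.map Prod.snd) * appell φ (v.map Prod.snd) := by
  intro n
  induction n using Nat.strong_induction_on with
  | _ n ih =>
    rintro (_ | ⟨x, u⟩) v hn huv hb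
    · simp [appell_nil hφ]
    rcases eq_or_ne v [] with rfl | hv
    · simp [appell_nil hφ]
    have H : ∀ u v : List (κ × A), (u ++ v).length < n → (∀ p ∈ u ++ v, p.2 ∈ B p.1) →
        (∀ p ∈ u.getLast?, ∀ q ∈ v.head?, p.1 ≠ q.1) → appell φ ((u ++ v).map Prod.snd) =
          appell φ (u.map Prod.snd) * appell φ (v.map Prod.snd) :=
      fun u v h => ih _ h u v rfl
    have hxB : x.2 ∈ B x.1 := huv x (by simp)
    have hmem : ∀ p ∈ u ++ v, p.2 ∈ B p.1 := fun p hp => huv p (List.mem_cons_of_mem _ hp)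
    have hlen : u.length + v.length + 1 = n := by simpa [add_assoc] using hn
    have hbu : ∀ p ∈ u.getLast?, ∀ q ∈ v.head?, p.1 ≠ q.1 := by
      intro p hp
      refine hb p ?_
      rcases u with _ | ⟨y, u⟩
      · simp at hp
      · simpa [List.getLast?_cons_cons] using hp
    -- a word with two labels contributes no cumulant
    have vanish : ∀ w : List (κ × A), w.length < n → (∀ p ∈ w, p.2 ∈ B p.1) →
        (∃ p ∈ w, p.1 ≠ x.1) → φ (x.2 * appell φ (w.map Prod.snd)) = 0 := by
      rintro w hw hwB ⟨p, hp, hpx⟩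
      obtain ⟨w1, w2, rfl, h1, h2⟩ := exists_eq_append_label x.1 w
      have hne : w2 ≠ [] := by
        rintro rfl
        rw [List.append_nil] at hp
        exact hpx (h1 p hp)
      rw [H w1 w2 hw hwB fun p hp q hq => by
        rw [h1 p (List.mem_of_mem_getLast? hp)]; exact h2 q hq]
      obtain ⟨L, hL, hLne, hLh, hLe⟩ := exists_reduced_appell hφ H _ w2 rfl
        (by simp at hw; omega) hne (fun q hq => hwB q (List.mem_append_right _ hq))
      -- x times A(w1) is one element of the algebra of x, in front of a reduced word whose first
      -- label is different.
      rw [hLe, ← mul_assoc]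
      refine apply_mul_reduced hφ hB (k := x.1) (Subalgebra.mul_mem _ hxB ?_) hL hLne ?_
      · refine appell_mem hφ _ _ rfl fun a ha => ?_
        obtain ⟨q, hq, rfl⟩ := List.mem_map.1 ha
        have h3 := hwB q (List.mem_append_left _ hq)
        rwa [h1 q hq] at h3
      · intro q hq
        obtain ⟨q', w', rfl⟩ := List.exists_cons_of_ne_nil hne
        rw [hLh q' (by simp) q hq]
        exact h2 q' (by simp)
    rw [List.cons_append, List.map_cons, List.map_cons, appell_cons hφ, appell_cons hφ,
      H u v (by simp; omega) hmem hbu, sub_mul, mul_assoc, Finset.sum_mul]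
    congr 1
    -- Split the cumulant sum at the end of u: prefixes that reach into v contribute nothing, and
    -- the others reproduce the recursion for A(x, u), multiplied on the right by A(v).
    have hl : ((u ++ v).map Prod.snd).length + 1 = ((u.map Prod.snd).length + 1) + v.length := by
      simp; omega
    rw [hl, Finset.sum_range_add]
    have hzero : ∀ j ∈ Finset.range v.length,
        φ (x.2 * appell φ (((u ++ v).map Prod.snd).take ((u.map Prod.snd).length + 1 + j))) •
          appell φ (((u ++ v).map Prod.snd).drop ((u.map Prod.snd).length + 1 + j)) = 0 := by
      intro j hj
      rw [Finset.mem_range] at hj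
      rw [← List.map_take, vanish _ (by rw [List.length_take]; simp; omega)
        (fun p hp => hmem p (List.mem_of_mem_take hp)), zero_smul]
      obtain ⟨y, v, rfl⟩ := List.exists_cons_of_ne_nil hv
      have hy : y ∈ (u ++ y :: v).take ((u.map Prod.snd).length + 1 + j) := by
        rw [List.length_map, add_assoc, List.take_length_add_append]
        refine List.mem_append_right _ ?_
        rw [add_comm, List.take_succ_cons]
        simp
      -- If the first letter y of v has the label of x, then x and y cannot be adjacent; so u is
      -- nonempty, and its last letter has a different label.
      by_cases hyx : y.1 = x.1
      · rcases eq_or_ne u [] with rfl | hu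
        · exact absurd hyx.symm (hb x (by simp) y (by simp))
        · refine ⟨u.getLast hu, ?_, ?_⟩
          · rw [List.length_map, add_assoc, List.take_length_add_append]
            exact List.mem_append_left _ (List.getLast_mem hu)
          · rw [← hyx]
            exact hbu _ (List.getLast?_eq_getLast_of_ne_nil hu ▸ rfl) y (by simp)
      · exact ⟨y, hy, hyx⟩
    rw [Finset.sum_eq_zero hzero, add_zero]
    refine Finset.sum_congr rfl fun k hk => ?_
    rw [Finset.mem_range, List.length_map] at hk
    rw [smul_mul_assoc, ← List.map_take, ← List.map_drop, List.take_append_of_le_length (by omega),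
      List.drop_append_of_le_length (by omega), H (u.drop k) v, List.map_take, List.map_drop]
    · rw [List.length_append, List.length_drop]; omega
    · intro p hp
      refine hmem p ?_
      rcases List.mem_append.1 hp with h | h
      · exact List.mem_append_left _ (List.mem_of_mem_drop h)
      · exact List.mem_append_right _ h
    · intro p hp
      refine hbu p ?_
      have h1 : u.getLast? = (u.take k ++ u.drop k).getLast? := by rw [List.take_append_drop]
      rw [h1, List.getLast?_append, hp]
      rfl

/-- The Appell polynomials of a word factor along its blocks. -/
theorem appell_flatten (hφ : φ 1 = 1) (hB : FreelyIndependent φ B) (bs : List (List (κ × A)))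
    (hne : ∀ b ∈ bs, b ≠ []) (hmem : ∀ b ∈ bs, ∀ p ∈ b, p.2 ∈ B p.1)
    (hch : bs.IsChain fun b c => ∀ p ∈ b.getLast?, ∀ q ∈ c.head?, p.1 ≠ q.1) :
    appell φ (bs.flatten.map Prod.snd) = (bs.map fun b => appell φ (b.map Prod.snd)).prod := by
  induction bs with
  | nil => simp [appell_nil hφ]
  | cons b bs ih =>
    rw [List.isChain_cons] at hch
    rw [List.flatten_cons, appell_append hφ hB _ b bs.flatten rfl, List.map_cons, List.prod_cons,
      ih (fun c hc => hne c (by simp [hc])) (fun c hc => hmem c (by simp [hc])) hch.2]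
    · intro p hp
      rcases List.mem_append.1 hp with h | h
      · exact hmem b (by simp) p h
      · obtain ⟨c, hc, hpc⟩ := List.mem_flatten.1 h
        exact hmem c (by simp [hc]) p hpc
    · intro p hp q hq
      rcases bs with _ | ⟨c, bs⟩
      · simp at hq
      · obtain ⟨y, c, rfl⟩ := List.exists_cons_of_ne_nil (hne c (by simp))
        exact hch.1 (y :: c) (by simp) p hp q (by simpa using hq)

/-- Factorization of the Appell polynomials along the classes of a partition. -/
theorem appell_eq_prod_classBlocks (hφ : φ 1 = 1) {ι : Type*} (X : ι → A) (π : Setoid ι)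
    (h : FreelyIndependentSets φ fun q : Quotient π => {a | ∃ i, Quotient.mk π i = q ∧ X i = a})
    (u : List ι) : appell φ (u.map X) =
      ((classBlocks π u).map fun v => appell φ (v.map X)).prod := by
  classical
  have key := appell_flatten hφ h
    ((classBlocks π u).map fun b => b.map fun i => (Quotient.mk π i, X i)) ?_ ?_ ?_
  · rw [← List.map_flatten, classBlocks, List.flatten_splitBy] at key
    simpa [Function.comp_def, classBlocks] using key
  · intro b hb
    obtain ⟨c, hc, rfl⟩ := List.mem_map.1 hb
    simpa using List.ne_nil_of_mem_splitBy hc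
  · intro b hb p hp
    obtain ⟨c, hc, rfl⟩ := List.mem_map.1 hb
    obtain ⟨i, hi, rfl⟩ := List.mem_map.1 hp
    exact Algebra.subset_adjoin ⟨i, rfl, rfl⟩
  · rw [List.isChain_map]
    refine (List.isChain_getLast_head_splitBy _ u).imp ?_
    rintro b c ⟨hb, hc, hbc⟩ p hp q hq
    rw [List.getLast?_map, List.getLast?_eq_getLast_of_ne_nil hb] at hp
    rw [List.head?_map, List.head?_eq_some_head hc] at hq
    simp only [Option.map_some, Option.mem_some_iff] at hp hq
    subst hp hq
    intro h1
    have h2 := Quotient.exact h1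
    simp only [decide_eq_false_iff_not] at hbc
    exact hbc h2

end Multivariate

/-! ### Resolvents, free cumulants and the one-variable polynomials -/

section OneVariable

open PowerSeries

variable {𝕜 : Type*} [RCLike 𝕜] {A : Type*} [Ring A] [Algebra 𝕜 A] {φ : A →ₗ[𝕜] 𝕜}

theorem map_algebraMap_commute (f : 𝕜⟦X⟧) (g : A⟦X⟧) :
    PowerSeries.map (algebraMap 𝕜 A) f * g = g * PowerSeries.map (algebraMap 𝕜 A) f := by
  ext n
  rw [coeff_mul, coeff_mul, ← Finset.Nat.sum_antidiagonal_swap]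
  refine Finset.sum_congr rfl fun p _ => ?_
  simp only [Prod.fst_swap, Prod.snd_swap, coeff_map]
  exact Algebra.commutes _ _

theorem apply_coeff_C_mul_map (a : A) (f : 𝕜⟦X⟧) (n : ℕ) :
    φ (coeff n (C a * PowerSeries.map (algebraMap 𝕜 A) f)) = φ a * coeff n f := by
  rw [coeff_C_mul, coeff_map, apply_mul_algebraMap, mul_comm]

theorem apply_coeff_map_mul (f : 𝕜⟦X⟧) {H : A⟦X⟧}
    (hH : ∀ n, φ (coeff n H) = if n = 0 then 1 else 0) (n : ℕ) :
    φ (coeff n (PowerSeries.map (algebraMap 𝕜 A) f * H)) = coeff n f := by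
  rw [coeff_mul, map_sum]
  simp only [coeff_map, apply_algebraMap_mul, hH]
  rw [Finset.sum_eq_single (n, 0)]
  · simp
  · rintro ⟨i, j⟩ hij hne
    rw [Finset.HasAntidiagonal.mem_antidiagonal] at hij
    rw [if_neg, mul_zero]
    rintro rfl
    exact hne (by simpa using hij)
  · simp

/-- A series `C` with a centered resolvent `(1 - Z z + C(z))⁻¹` is the free cumulant series. -/
theorem eq_freeCumulantSeries (hφ : φ 1 = 1) (Z : A) (c : 𝕜⟦X⟧) (hc : constantCoeff c = 0)
    (H : A⟦X⟧) (hH : (1 - C Z * X + PowerSeries.map (algebraMap 𝕜 A) c) * H = 1)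
    (hφH : ∀ n, φ (coeff n H) = if n = 0 then 1 else 0) :
    c = freeCumulantSeries (fun k => φ (Z ^ k)) := by
  set m : ℕ → 𝕜 := fun k => φ (Z ^ k) with hm
  have hD0 : constantCoeff (1 + c) ≠ 0 := by simp [hc]
  -- W = z / (1 + c) turns the resolvent equation into K = 1 + Z W K for K = (1 + c) H. It will
  -- prove to be the compositional inverse of z M(z).
  obtain ⟨W, hWdef⟩ : ∃ W : 𝕜⟦X⟧, W = X * (1 + c)⁻¹ := ⟨_, rfl⟩
  have hW0 : constantCoeff W = 0 := by simp [hWdef]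
  have hWD : W * (1 + c) = X := by
    rw [hWdef, mul_assoc, PowerSeries.inv_mul_cancel _ hD0, mul_one]
  have hWs : HasSubst W := HasSubst.of_constantCoeff_zero' hW0
  obtain ⟨K, hK⟩ : ∃ K : A⟦X⟧, K = PowerSeries.map (algebraMap 𝕜 A) (1 + c) * H := ⟨_, rfl⟩
  have hK1 : K = 1 + C Z * PowerSeries.map (algebraMap 𝕜 A) W * K := by
    have h1 : C Z * PowerSeries.map (algebraMap 𝕜 A) W * K = C Z * X * H := by
      rw [hK, ← mul_assoc, mul_assoc (C Z), ← map_mul, hWD, map_X]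
    rw [h1, ← hH, hK, map_add, map_one]
    noncomm_ring
  -- Iteration gives a geometric series whose remainder is divisible by z ^ N, because W is
  -- divisible by z.
  have hKN : ∀ N : ℕ, K = ∑ k ∈ Finset.range N,
      C (Z ^ k) * PowerSeries.map (algebraMap 𝕜 A) (W ^ k) +
        C (Z ^ N) * PowerSeries.map (algebraMap 𝕜 A) (W ^ N) * K := by
    intro N
    induction N with
    | zero => simp
    | succ N ih =>
      have h2 : C (Z ^ N) * PowerSeries.map (algebraMap 𝕜 A) (W ^ N) * K =
          C (Z ^ N) * PowerSeries.map (algebraMap 𝕜 A) (W ^ N) +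
          C (Z ^ (N + 1)) * PowerSeries.map (algebraMap 𝕜 A) (W ^ (N + 1)) * K := by
        conv_lhs => rw [hK1, mul_add, mul_one]
        congr 1
        rw [pow_succ, pow_succ, map_mul C, map_mul (PowerSeries.map _), ← mul_assoc, ← mul_assoc,
          mul_assoc (C (Z ^ N)), map_algebraMap_commute]
        simp only [mul_assoc]
      rw [Finset.sum_range_succ, add_assoc, ← h2, ← ih]
  -- Apply φ to K: since H is centered, one side is 1 + c; the geometric series gives M(W). For the
  -- coefficient n it suffices to iterate n + 1 times.
  have hsub : (PowerSeries.mk m).subst W = 1 + c := by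
    ext n
    rw [← apply_coeff_map_mul (φ := φ) (1 + c) hφH n, ← hK, hKN (n + 1), map_add, map_add, map_sum,
      map_sum, coeff_subst' hWs, finsum_eq_sum_of_support_subset (s := Finset.range (n + 1))]
    · have h0 : coeff n (C (Z ^ (n + 1)) * PowerSeries.map (algebraMap 𝕜 A) (W ^ (n + 1)) * K)
          = 0 := by
        rw [hWdef, mul_pow, map_mul (PowerSeries.map _), map_pow (PowerSeries.map _), map_X, ← mul_assoc, (commute_X_pow _ _).eq, mul_assoc,
          mul_assoc, coeff_X_pow_mul', if_neg (by omega)]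
      rw [h0, map_zero, add_zero]
      refine Finset.sum_congr rfl fun k _ => ?_
      rw [apply_coeff_C_mul_map, coeff_mk, smul_eq_mul]
    · intro k hk
      rw [Function.mem_support] at hk
      simp only [Finset.coe_range, Set.mem_Iio]
      by_contra hlt
      apply hk
      rw [hWdef, mul_pow, coeff_X_pow_mul', if_neg (by omega), smul_zero]
  obtain ⟨hR0, hR⟩ := isFreeCumulantSeries_freeCumulantSeries m (by simp [hm, hφ])
  set R := freeCumulantSeries m
  have hMs : HasSubst (X * PowerSeries.mk m) := HasSubst.of_constantCoeff_zero' (by simp)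
  have h3 : (X * PowerSeries.mk m).subst W = (X : 𝕜⟦X⟧) := by
    rw [subst_mul hWs, hsub, subst_X hWs]
    exact hWD
  -- Substituting W into 1 + R(z M(z)) = M(z) yields 1 + R(z) = 1 + c(z).
  have h4 := congrArg (PowerSeries.subst W) hR
  rw [subst_add hWs, subst_comp_subst_apply hMs hWs, h3, X_subst, hsub] at h4
  have h5 : (1 : 𝕜⟦X⟧).subst W = (1 : 𝕜⟦X⟧) := by
    rw [← coe_substAlgHom hWs, map_one]
  rw [h5] at h4
  exact (add_left_cancel h4).symm

/-- The generating function of the free Appell polynomials of `Z`, evaluated at `Z`. -/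
noncomputable def appellSeries (φ : A →ₗ[𝕜] 𝕜) (Z : A) : A⟦X⟧ :=
  PowerSeries.mk fun n => appellOne φ n Z

theorem appellSeries_eq_map (φ : A →ₗ[𝕜] 𝕜) (Z : A) : appellSeries φ Z =
    PowerSeries.map (Polynomial.aeval Z : Polynomial 𝕜 →ₐ[𝕜] A).toRingHom
      (invOfUnit (1 - C Polynomial.X * X +
        PowerSeries.map Polynomial.C (freeCumulantSeries fun k => φ (Z ^ k))) 1) := by
  ext n
  rw [appellSeries, coeff_mk, coeff_map]
  rfl

theorem map_resolvent (R : 𝕜⟦X⟧) (Z : A) :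
    PowerSeries.map (Polynomial.aeval Z : Polynomial 𝕜 →ₐ[𝕜] A).toRingHom
      (1 - C Polynomial.X * X + PowerSeries.map Polynomial.C R) =
      1 - C Z * X + PowerSeries.map (algebraMap 𝕜 A) R := by
  rw [map_add, map_sub, map_one, map_mul, map_C, map_X]
  congr 1
  · simp
  · ext n
    simp

theorem constantCoeff_resolvent (hφ : φ 1 = 1) (Z : A) :
    constantCoeff (1 - C Polynomial.X * X +
      PowerSeries.map Polynomial.C (freeCumulantSeries fun k => φ (Z ^ k))) =
        ((1 : (Polynomial 𝕜)ˣ) : Polynomial 𝕜) := by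
  have h := (isFreeCumulantSeries_freeCumulantSeries (fun k => φ (Z ^ k)) (by simp [hφ])).1
  rw [← coeff_zero_eq_constantCoeff_apply] at h ⊢
  rw [map_add, coeff_map, h]
  simp

theorem resolvent_mul_appellSeries (hφ : φ 1 = 1) (Z : A) :
    (1 - C Z * X + PowerSeries.map (algebraMap 𝕜 A) (freeCumulantSeries fun k => φ (Z ^ k))) *
      appellSeries φ Z = 1 := by
  rw [appellSeries_eq_map, ← map_resolvent, ← map_mul,
    mul_invOfUnit _ _ (constantCoeff_resolvent hφ Z), map_one]

theorem appellSeries_mul_resolvent (hφ : φ 1 = 1) (Z : A) :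
    appellSeries φ Z *
      (1 - C Z * X + PowerSeries.map (algebraMap 𝕜 A) (freeCumulantSeries fun k => φ (Z ^ k))) =
        1 := by
  rw [appellSeries_eq_map, ← map_resolvent, ← map_mul,
    invOfUnit_mul _ _ (constantCoeff_resolvent hφ Z), map_one]

/-- A centered resolvent of `Z` is the generating function of its free Appell polynomials. -/
theorem eq_appellSeries (hφ : φ 1 = 1) (Z : A) (c : 𝕜⟦X⟧) (hc : constantCoeff c = 0)
    (H : A⟦X⟧) (hH : (1 - C Z * X + PowerSeries.map (algebraMap 𝕜 A) c) * H = 1)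
    (hφH : ∀ n, φ (coeff n H) = if n = 0 then 1 else 0) : H = appellSeries φ Z := by
  -- With c identified, H is a right inverse of a series of which the Appell series is a left
  -- inverse.
  rw [eq_freeCumulantSeries hφ Z c hc H hH hφH] at hH
  exact (left_inv_eq_right_inv (appellSeries_mul_resolvent hφ Z) hH).symm

/-- Read coefficientwise, the recursion `appell_cons` for constant words says that the series of the
A(Z, ..., Z) is a resolvent with c(z) = ∑ φ(Z A(Z, ..., Z)) z ^ (k + 1), the inner word having
length k. It is centered by definition. -/
theorem appellOne_eq_appell (hφ : φ 1 = 1) (Z : A) (n : ℕ) :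
    appellOne φ n Z = appell φ (List.replicate n Z) := by
  have key := eq_appellSeries hφ Z
    (X * PowerSeries.mk fun k => φ (Z * appell φ (List.replicate k Z))) ?_
    (PowerSeries.mk fun n => appell φ (List.replicate n Z)) ?_ ?_
  · have h := congrArg (coeff n) key
    rw [appellSeries, coeff_mk, coeff_mk] at h
    exact h.symm
  · simp
  · ext n
    rw [add_mul, sub_mul, one_mul, mul_assoc, map_add, map_sub, coeff_C_mul]
    rcases n with _ | n
    · simp [coeff_mul, appell_nil hφ]
    · rw [coeff_succ_X_mul, coeff_mul, Finset.Nat.sum_antidiagonal_succ]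
      simp only [coeff_mk, coeff_map, coeff_zero_X_mul, coeff_succ_X_mul, map_zero, zero_mul,
        zero_add, coeff_one]
      rw [Finset.Nat.sum_antidiagonal_eq_sum_range_succ_mk, List.replicate_succ, appell_cons hφ,
        if_neg (by omega), List.length_replicate]
      have : ∀ k ∈ Finset.range (n + 1),
          φ (Z * appell φ ((List.replicate n Z).take k)) • appell φ ((List.replicate n Z).drop k) =
          algebraMap 𝕜 A (φ (Z * appell φ (List.replicate k Z))) *
            appell φ (List.replicate (n - k) Z) := by
        intro k hk
        rw [Finset.mem_range] at hk
        rw [List.take_replicate, List.drop_replicate, min_eq_left (by omega), Algebra.smul_def]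
      rw [Finset.sum_congr rfl this]
      abel
  · rintro (_ | n)
    · simp [appell_nil hφ, hφ]
    · rw [coeff_mk, apply_appell hφ (by simp), if_neg (by omega)]

theorem appellOne_zero (hφ : φ 1 = 1) (Z : A) : appellOne φ 0 Z = 1 := by
  rw [appellOne_eq_appell hφ, List.replicate_zero, appell_nil hφ]

theorem apply_appellOne (hφ : φ 1 = 1) (Z : A) {n : ℕ} (hn : n ≠ 0) : φ (appellOne φ n Z) = 0 := by
  rw [appellOne_eq_appell hφ, apply_appell hφ (by simpa using hn)]

theorem appellOne_mem {S : Subalgebra 𝕜 A} {Z : A} (hZ : Z ∈ S) (n : ℕ) : appellOne φ n Z ∈ S :=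
  Algebra.adjoin_le (Set.singleton_subset_iff.2 hZ) (Polynomial.aeval_mem_adjoin_singleton 𝕜 Z)

end OneVariable

/-! ### Alternating products and the free binomial formula -/

section Alternating

variable {𝕜 : Type*} [RCLike 𝕜] {A : Type*} [Ring A] [Algebra 𝕜 A] {κ : Type*}
  {φ : A →ₗ[𝕜] 𝕜} {B : κ → Subalgebra 𝕜 A}

/-- The sum of the alternating products `f u_1 * g u_2 * f u_3 * ⋯` over all compositions
`u_1 + u_2 + ⋯ = n`. -/
def altSum (f g : ℕ → A) (n : ℕ) : A := ∑ u : Composition n, altProd f g u.blocks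

theorem altSum_zero (f g : ℕ → A) : altSum f g 0 = 1 := by
  have h : ∀ u : Composition 0, altProd f g u.blocks = 1 := by
    intro u
    rw [(u.blocks_eq_nil).2 rfl, altProd]
  rw [altSum, Fintype.sum_congr _ _ h]
  simp [composition_card]

/-- Split off the first block of the composition; blocks are positive, hence the `p.1 + 1`, and the
remaining product starts with g. -/
theorem altSum_succ (f g : ℕ → A) (n : ℕ) : altSum f g (n + 1) =
    ∑ p ∈ Finset.HasAntidiagonal.antidiagonal n, f (p.1 + 1) * altSum g f p.2 := by
  simp only [altSum, Finset.mul_sum]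
  rw [Finset.sum_sigma' (Finset.HasAntidiagonal.antidiagonal n) (fun _ => Finset.univ)]
  symm
  refine Finset.sum_bij (fun x hx => ⟨(x.1.1 + 1) :: x.2.blocks, ?_, ?_⟩) ?_ ?_ ?_ ?_
  · intro i hi
    rcases List.mem_cons.1 hi with rfl | h
    · omega
    · exact x.2.blocks_pos h
  · have h := Finset.HasAntidiagonal.mem_antidiagonal.1 (Finset.mem_sigma.1 hx).1
    rw [List.sum_cons, x.2.blocks_sum]
    omega
  · simp
  · rintro ⟨⟨a, b⟩, u⟩ hx ⟨⟨a', b'⟩, u'⟩ hx' h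
    have h1 := Finset.HasAntidiagonal.mem_antidiagonal.1 (Finset.mem_sigma.1 hx).1
    have h2 := Finset.HasAntidiagonal.mem_antidiagonal.1 (Finset.mem_sigma.1 hx').1
    simp only [Composition.mk.injEq, List.cons.injEq] at h h1 h2
    obtain rfl : a = a' := by omega
    obtain rfl : b = b' := by omega
    obtain rfl : u = u' := Composition.ext h.2
    rfl
  · intro u _
    have hne : u.blocks ≠ [] := by
      rw [ne_eq, u.blocks_eq_nil]
      omega
    obtain ⟨a, l, hl⟩ := List.exists_cons_of_ne_nil hne
    have ha : 0 < a := u.blocks_pos (by rw [hl]; simp)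
    have hs : a + l.sum = n + 1 := by rw [← List.sum_cons, ← hl, u.blocks_sum]
    refine ⟨⟨(a - 1, l.sum), ⟨l, fun {i} hi => u.blocks_pos (by rw [hl]; simp [hi]), rfl⟩⟩, ?_, ?_⟩
    · rw [Finset.mem_sigma]
      exact ⟨Finset.HasAntidiagonal.mem_antidiagonal.2 (by simp only; omega), Finset.mem_univ _⟩
    · refine Composition.ext ?_
      exact (congrArg (· :: l) (Nat.sub_add_cancel ha)).trans hl.symm
  · rintro ⟨⟨a, b⟩, u⟩ _
    rfl

theorem exists_reduced_altProd {i j : κ} (hij : i ≠ j) {f g : ℕ → A}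
    (hf : ∀ n, f n ∈ B i) (hf0 : ∀ n ≠ 0, φ (f n) = 0)
    (hg : ∀ n, g n ∈ B j) (hg0 : ∀ n ≠ 0, φ (g n) = 0) (u : List ℕ) (hu : ∀ n ∈ u, n ≠ 0) :
    ∃ L : List (κ × A), IsReduced φ B L ∧ (u ≠ [] → L ≠ []) ∧ (∀ p ∈ L.head?, p.1 = i) ∧
      altProd f g u = (L.map Prod.snd).prod := by
  induction u generalizing i j f g with
  | nil => exact ⟨[], isReduced_nil, by simp, by simp, by simp [altProd]⟩
  | cons a u ih =>
    obtain ⟨L, hL, -, hh, hp⟩ := ih hij.symm hg hg0 hf hf0 fun n hn => hu n (by simp [hn])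
    refine ⟨(i, f a) :: L, isReduced_cons.2 ⟨⟨hf a, hf0 a (hu a (by simp))⟩, ?_, hL⟩, by simp,
      by simp, by simp [altProd, hp]⟩
    intro q hq
    rw [hh q hq]
    exact hij

theorem apply_altSum (hB : FreelyIndependent φ B) {i j : κ} (hij : i ≠ j) {f g : ℕ → A}
    (hf : ∀ n, f n ∈ B i) (hf0 : ∀ n ≠ 0, φ (f n) = 0)
    (hg : ∀ n, g n ∈ B j) (hg0 : ∀ n ≠ 0, φ (g n) = 0) {n : ℕ} (hn : n ≠ 0) :
    φ (altSum f g n) = 0 := by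
  rw [altSum, map_sum]
  refine Finset.sum_eq_zero fun u _ => ?_
  obtain ⟨L, hL, hne, -, hp⟩ := exists_reduced_altProd hij hf hf0 hg hg0 u.blocks
    fun m hm => (u.blocks_pos hm).ne'
  rw [hp]
  exact hL.apply_prod_eq_zero hB (hne (by rwa [ne_eq, u.blocks_eq_nil]))

open PowerSeries

theorem mk_altSum {f g : ℕ → A} (hf : f 0 = 1) :
    PowerSeries.mk (altSum f g) =
      1 + (PowerSeries.mk f - 1) * PowerSeries.mk (altSum g f) := by
  ext n
  rw [coeff_mk, map_add, coeff_mul]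
  rcases n with _ | n
  · simp [altSum_zero, hf]
  · rw [Finset.Nat.sum_antidiagonal_succ, altSum_succ]
    simp [coeff_one, hf]

/-- Let a, b be the resolvent denominators of x, y, let P, Q be the two alternating series and T = P
+ Q - 1, the empty composition being counted twice in P + Q. By `mk_altSum`, T = a⁻¹ Q = b⁻¹ P, so
(a + b - 1) T = Q + P - T = 1. As T is centered by freeness, `eq_appellSeries` applies with the sum
of the two cumulant series. -/
theorem appellSeries_add (hφ : φ 1 = 1) (hB : FreelyIndependent φ B) {i j : κ} (hij : i ≠ j)
    {x y : A} (hx : x ∈ B i) (hy : y ∈ B j) :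
    PowerSeries.mk (altSum (fun n => appellOne φ n x) (fun n => appellOne φ n y)) +
      PowerSeries.mk (altSum (fun n => appellOne φ n y) (fun n => appellOne φ n x)) - 1 =
        appellSeries φ (x + y) := by
  have h1 : ∀ z : A, constantCoeff (freeCumulantSeries fun k => φ (z ^ k)) = 0 := fun z =>
    (isFreeCumulantSeries_freeCumulantSeries (fun k => φ (z ^ k)) (by simp [hφ])).1
  have hP := mk_altSum (f := fun n => appellOne φ n x) (g := fun n => appellOne φ n y)
    (appellOne_zero hφ x)
  have hQ := mk_altSum (f := fun n => appellOne φ n y) (g := fun n => appellOne φ n x)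
    (appellOne_zero hφ y)
  have ha := resolvent_mul_appellSeries hφ x
  have hb := resolvent_mul_appellSeries hφ y
  rw [← appellSeries] at hP hQ
  refine eq_appellSeries hφ (x + y) ((freeCumulantSeries fun k => φ (x ^ k)) +
    freeCumulantSeries fun k => φ (y ^ k)) (by rw [map_add, h1, h1, add_zero]) _ ?_ ?_
  · set P := PowerSeries.mk (altSum (fun n => appellOne φ n x) (fun n => appellOne φ n y))
    set Q := PowerSeries.mk (altSum (fun n => appellOne φ n y) (fun n => appellOne φ n x))
    set a := 1 - C x * X + PowerSeries.map (algebraMap 𝕜 A) (freeCumulantSeries fun k => φ (x ^ k))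
      with hadef
    set b := 1 - C y * X + PowerSeries.map (algebraMap 𝕜 A) (freeCumulantSeries fun k => φ (y ^ k))
      with hbdef
    have hab : 1 - C (x + y) * X + PowerSeries.map (algebraMap 𝕜 A)
        ((freeCumulantSeries fun k => φ (x ^ k)) + freeCumulantSeries fun k => φ (y ^ k)) =
        a + b - 1 := by
      rw [hadef, hbdef, map_add, map_add, add_mul]
      abel
    have hTx : P + Q - 1 = appellSeries φ x * Q := by
      rw [hP]
      noncomm_ring
    have hTy : P + Q - 1 = appellSeries φ y * P := by
      conv_lhs => rw [hQ]
      noncomm_ring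
    have haT : a * (P + Q - 1) = Q := by rw [hTx, ← mul_assoc, ha, one_mul]
    have hbT : b * (P + Q - 1) = P := by rw [hTy, ← mul_assoc, hb, one_mul]
    rw [hab, sub_mul, add_mul, haT, hbT, one_mul]
    abel
  · intro n
    rw [map_sub, map_add, coeff_mk, coeff_mk, coeff_one]
    split_ifs with hn
    · simp [hn, altSum_zero, hφ]
    · rw [map_sub, map_add, map_zero, sub_zero,
        apply_altSum hB hij (appellOne_mem hx) (fun n => apply_appellOne hφ x) (appellOne_mem hy)
          (fun n => apply_appellOne hφ y) hn,
        apply_altSum hB hij.symm (appellOne_mem hy) (fun n => apply_appellOne hφ y)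
          (appellOne_mem hx) (fun n => apply_appellOne hφ x) hn, add_zero]

/-- The free binomial formula. -/
theorem appellOne_add (hφ : φ 1 = 1) (hB : FreelyIndependent φ B) {i j : κ} (hij : i ≠ j)
    {x y : A} (hx : x ∈ B i) (hy : y ∈ B j) {n : ℕ} (hn : n ≠ 0) :
    appellOne φ n (x + y) = altSum (fun k => appellOne φ k x) (fun k => appellOne φ k y) n +
      altSum (fun k => appellOne φ k y) (fun k => appellOne φ k x) n := by
  have h := congrArg (coeff n) (appellSeries_add hφ hB hij hx hy)
  rw [appellSeries, map_sub, map_add, coeff_mk, coeff_mk, coeff_mk, coeff_one, if_neg hn,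
    sub_zero] at h
  exact h.symm

theorem altSum_add_altSum_eq_sum_length (f g : ℕ → A) {n : ℕ} (hn : 1 ≤ n) :
    altSum f g n + altSum g f n = ∑ k ∈ Finset.Icc 1 n, ∑ u : Composition n with u.length = k,
      (altProd f g u.blocks + altProd g f u.blocks) := by
  rw [altSum, altSum, ← Finset.sum_add_distrib]
  refine (Finset.sum_fiberwise_of_maps_to (fun u _ => ?_) _).symm
  rw [Finset.mem_Icc]
  exact ⟨u.length_pos_iff.2 hn, u.length_le⟩

end Alternating

/-! ### Conditional expectations of alternating products -/

section CondExp

variable {𝕜 : Type*} [RCLike 𝕜] {A : Type*} [Ring A] [Algebra 𝕜 A] {κ : Type*}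
  {φ : A →ₗ[𝕜] 𝕜} {B : κ → Subalgebra 𝕜 A}

/-- The elements whose conditional expectation onto the subalgebra `S` is zero. -/
def condKernel (φ : A →ₗ[𝕜] 𝕜) (S : Subalgebra 𝕜 A) : Submodule 𝕜 A where
  carrier := {a | ∀ b ∈ S, ∀ b' ∈ S, φ (b * a * b') = 0}
  add_mem' ha ha' b hb b' hb' := by rw [mul_add, add_mul, map_add, ha b hb b' hb', ha' b hb b' hb',
    add_zero]
  zero_mem' b _ b' _ := by simp
  smul_mem' c a ha b hb b' hb' := by
    rw [mul_smul_comm, smul_mul_assoc, map_smul, ha b hb b' hb', smul_zero]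

theorem mul_mem_condKernel {S : Subalgebra 𝕜 A} {a s : A} (hs : s ∈ S)
    (ha : a ∈ condKernel φ S) : s * a ∈ condKernel φ S := by
  intro b hb b' hb'
  rw [← mul_assoc]
  exact ha _ (S.mul_mem hb hs) b' hb'

theorem reduced_mem_condKernel_of_ends (hφ : φ 1 = 1) (hB : FreelyIndependent φ B) {i : κ}
    {L : List (κ × A)} (hL : IsReduced φ B L) (hne : L ≠ []) (hh : ∀ p ∈ L.head?, i ≠ p.1)
    (hl : ∀ p ∈ L.getLast?, p.1 ≠ i) : (L.map Prod.snd).prod ∈ condKernel φ (B i) := by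
  intro b hb b' hb'
  have h1 : IsReduced φ B (L ++ [(i, b' - algebraMap 𝕜 A (φ b'))]) :=
    isReduced_append.2 ⟨hL, isReduced_cons.2 ⟨⟨Subalgebra.sub_mem _ hb'
      (Subalgebra.algebraMap_mem _ _), apply_sub_algebraMap hφ b'⟩, by simp, isReduced_nil⟩,
      fun p hp q hq => by
        simp only [List.head?_cons, Option.mem_some_iff] at hq
        subst hq
        exact hl p hp⟩
  have h2 := apply_mul_reduced hφ hB hb h1 (by simp) fun q hq => by
    obtain ⟨p, L, rfl⟩ := List.exists_cons_of_ne_nil hne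
    exact hh q (by simpa using hq)
  rw [List.map_append, List.prod_append, List.map_cons, List.map_nil, List.prod_singleton,
    ← mul_assoc, mul_sub, map_sub, apply_mul_algebraMap,
    apply_mul_reduced hφ hB hb hL hne hh, mul_zero, sub_zero] at h2
  exact h2

/-- A last letter from `B i` can be absorbed into the right test element b'. What remains is
nonempty, since the first letter is not from `B i`, and ends outside `B i`. -/
theorem reduced_mem_condKernel (hφ : φ 1 = 1) (hB : FreelyIndependent φ B) {i : κ}
    {L : List (κ × A)} (hL : IsReduced φ B L) (hne : L ≠ []) (hh : ∀ p ∈ L.head?, i ≠ p.1) :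
    (L.map Prod.snd).prod ∈ condKernel φ (B i) := by
  by_cases hl : ∀ p ∈ L.getLast?, p.1 ≠ i
  · exact reduced_mem_condKernel_of_ends hφ hB hL hne hh hl
  push Not at hl
  obtain ⟨p, hp, rfl⟩ := hl
  obtain ⟨M, rfl⟩ : ∃ M, L = M ++ [p] := by
    obtain ⟨M, hM⟩ := List.getLast?_eq_some_iff.1 hp
    exact ⟨M, hM⟩
  rw [isReduced_append] at hL
  have hM : M ≠ [] := by
    rintro rfl
    exact hh p (by simp) rfl
  intro b hb b' hb'
  have h1 := reduced_mem_condKernel_of_ends hφ hB hL.1 hM (fun q hq => hh q (by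
    obtain ⟨r, M, rfl⟩ := List.exists_cons_of_ne_nil hM
    simpa using hq)) (fun q hq => hL.2.2 q hq p (by simp)) b hb (p.2 * b')
    (Subalgebra.mul_mem _ (hL.2.1.2 p (by simp)).1 hb')
  rw [List.map_append, List.prod_append, List.map_cons, List.map_nil, List.prod_singleton]
  simpa only [mul_assoc] using h1

theorem altSum_mem_condKernel (hφ : φ 1 = 1) (hB : FreelyIndependent φ B) {i j : κ} (hij : i ≠ j)
    {f g : ℕ → A} (hf : ∀ n, f n ∈ B i) (hf0 : ∀ n ≠ 0, φ (f n) = 0)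
    (hg : ∀ n, g n ∈ B j) (hg0 : ∀ n ≠ 0, φ (g n) = 0) {n : ℕ} (hn : n ≠ 0) :
    altSum g f n ∈ condKernel φ (B i) := by
  refine Submodule.sum_mem _ fun u _ => ?_
  obtain ⟨L, hL, hne, hh, hp⟩ := exists_reduced_altProd hij.symm hg hg0 hf hf0 u.blocks
    fun m hm => (u.blocks_pos hm).ne'
  rw [hp]
  refine reduced_mem_condKernel hφ hB hL (hne (by rwa [ne_eq, u.blocks_eq_nil])) fun p hp => ?_
  rw [hh p hp]
  exact hij

/-- The one-block composition gives `f n`. Every other term has a first factor in `B i`, which the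
left test element absorbs, followed by a sum of reduced words that start in `B j`. -/
theorem altSum_sub_mem_condKernel (hφ : φ 1 = 1) (hB : FreelyIndependent φ B) {i j : κ}
    (hij : i ≠ j) {f g : ℕ → A} (hf : ∀ n, f n ∈ B i) (hf0 : ∀ n ≠ 0, φ (f n) = 0)
    (hg : ∀ n, g n ∈ B j) (hg0 : ∀ n ≠ 0, φ (g n) = 0) {n : ℕ} (hn : n ≠ 0) :
    altSum f g n - f n ∈ condKernel φ (B i) := by
  obtain ⟨n, rfl⟩ := Nat.exists_eq_succ_of_ne_zero hn
  rw [Nat.succ_eq_add_one, altSum_succ, ← Finset.add_sum_erase _ _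
    (show (n, 0) ∈ Finset.HasAntidiagonal.antidiagonal n from Finset.HasAntidiagonal.mem_antidiagonal.2 (by simp)),
    altSum_zero, mul_one, add_sub_cancel_left]
  refine Submodule.sum_mem _ fun p hp => mul_mem_condKernel (hf _)
    (altSum_mem_condKernel hφ hB hij hf hf0 hg hg0 ?_)
  rw [Finset.mem_erase, Finset.HasAntidiagonal.mem_antidiagonal] at hp
  intro h
  exact hp.1 (Prod.ext (by simp only; omega) h)

theorem isCondExp_appellOne_add (hφ : φ 1 = 1) (hB : FreelyIndependent φ B) {i j : κ}
    (hij : i ≠ j) {x y : A} (hx : x ∈ B i) (hy : y ∈ B j) (n : ℕ) :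
    IsCondExp φ (B i) (appellOne φ n (x + y)) (appellOne φ n x) := by
  refine ⟨appellOne_mem hx n, fun b hb b' hb' => ?_⟩
  rcases eq_or_ne n 0 with rfl | hn
  · rw [appellOne_zero hφ, appellOne_zero hφ]
  have h := Submodule.add_mem _
    (altSum_sub_mem_condKernel hφ hB hij (appellOne_mem hx) (fun n => apply_appellOne hφ x)
      (appellOne_mem hy) (fun n => apply_appellOne hφ y) hn)
    (altSum_mem_condKernel hφ hB hij (appellOne_mem hx) (fun n => apply_appellOne hφ x)
      (appellOne_mem hy) (fun n => apply_appellOne hφ y) hn) b hb b' hb'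
  rw [sub_add_eq_add_sub, ← appellOne_add hφ hB hij hx hy hn, mul_sub, sub_mul, map_sub,
    sub_eq_zero] at h
  exact h

end CondExp

/-! ### Freeness of disjoint groups of free algebras -/

section Grouping

variable {𝕜 : Type*} [RCLike 𝕜] {A : Type*} [Ring A] [Algebra 𝕜 A] {κ : Type*}
  {φ : A →ₗ[𝕜] 𝕜} {B : κ → Subalgebra 𝕜 A}

theorem FreelyIndependent.mono {C : κ → Subalgebra 𝕜 A} (hB : FreelyIndependent φ B)
    (h : ∀ k, C k ≤ B k) : FreelyIndependent φ C := fun L hne hch hL =>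
  hB L hne hch fun p hp => ⟨h _ (hL p hp).1, (hL p hp).2⟩

/-- The span of the products of nonempty reduced words with labels in `T`. -/
def reducedSpan (φ : A →ₗ[𝕜] 𝕜) (B : κ → Subalgebra 𝕜 A) (T : Set κ) : Submodule 𝕜 A :=
  Submodule.span 𝕜 {a | ∃ L : List (κ × A), IsReduced φ B L ∧ L ≠ [] ∧ (∀ p ∈ L, p.1 ∈ T) ∧
    (L.map Prod.snd).prod = a}

/-- The span of the products of nonempty reduced words of which the first label is in `T`. -/
def headSpan (φ : A →ₗ[𝕜] 𝕜) (B : κ → Subalgebra 𝕜 A) (T : Set κ) : Submodule 𝕜 A :=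
  Submodule.span 𝕜 {a | ∃ L : List (κ × A), IsReduced φ B L ∧ L ≠ [] ∧ (∀ p ∈ L.head?, p.1 ∈ T) ∧
    (L.map Prod.snd).prod = a}

theorem apply_eq_zero_of_mem_headSpan (hB : FreelyIndependent φ B) {T : Set κ} {a : A}
    (ha : a ∈ headSpan φ B T) : φ a = 0 := by
  refine (Submodule.span_le (p := LinearMap.ker φ)).2 ?_ ha
  rintro _ ⟨L, hL, hne, -, rfl⟩
  exact hL.apply_prod_eq_zero hB hne

theorem reducedSpan_le_headSpan (T : Set κ) : reducedSpan φ B T ≤ headSpan φ B T := by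
  refine Submodule.span_mono ?_
  rintro _ ⟨L, hL, hne, hT, rfl⟩
  exact ⟨L, hL, hne, fun p hp => hT p (List.mem_of_mem_head? hp), rfl⟩

theorem word_mem_sup_reducedSpan {T : Set κ} {L : List (κ × A)} (hL : IsReduced φ B L)
    (hT : ∀ p ∈ L, p.1 ∈ T) :
    (L.map Prod.snd).prod ∈ Submodule.span 𝕜 {(1 : A)} ⊔ reducedSpan φ B T := by
  rcases eq_or_ne L [] with rfl | hne
  · exact Submodule.mem_sup_left (Submodule.subset_span (by simp))
  · exact Submodule.mem_sup_right (Submodule.subset_span ⟨L, hL, hne, hT, rfl⟩)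

/-- `a * w` for `a` in `B k` and a reduced word `w` of which the first label is not `k`. -/
theorem mul_word_mem_sup_reducedSpan (hφ : φ 1 = 1) {T : Set κ} {k : κ} (hk : k ∈ T) {a : A}
    (ha : a ∈ B k) {L : List (κ × A)} (hL : IsReduced φ B L) (hT : ∀ p ∈ L, p.1 ∈ T)
    (hh : ∀ q ∈ L.head?, k ≠ q.1) :
    a * (L.map Prod.snd).prod ∈ Submodule.span 𝕜 {(1 : A)} ⊔ reducedSpan φ B T := by
  have h1 := word_mem_sup_reducedSpan (T := T) (L := (k, a - algebraMap 𝕜 A (φ a)) :: L)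
    (isReduced_cons.2 ⟨⟨Subalgebra.sub_mem _ ha (Subalgebra.algebraMap_mem _ _),
      apply_sub_algebraMap hφ a⟩, hh, hL⟩) (by simpa [hk] using hT)
  have h2 := Submodule.add_mem _ h1
    (Submodule.smul_mem _ (φ a) (word_mem_sup_reducedSpan hL hT))
  rw [List.map_cons, List.prod_cons, sub_mul, Algebra.smul_def, sub_add_cancel] at h2
  exact h2

theorem mul_mem_sup_reducedSpan (hφ : φ 1 = 1) {T : Set κ} {k : κ} (hk : k ∈ T) {a : A}
    (ha : a ∈ B k) {v : A} (hv : v ∈ Submodule.span 𝕜 {(1 : A)} ⊔ reducedSpan φ B T) :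
    a * v ∈ Submodule.span 𝕜 {(1 : A)} ⊔ reducedSpan φ B T := by
  refine (sup_le (c := (Submodule.span 𝕜 {(1 : A)} ⊔ reducedSpan φ B T).comap
    (LinearMap.mulLeft 𝕜 a)) ?_ ?_) hv
  · rw [Submodule.span_le, Set.singleton_subset_iff]
    exact mul_word_mem_sup_reducedSpan hφ hk ha isReduced_nil (by simp) (by simp)
  · rw [reducedSpan, Submodule.span_le]
    rintro _ ⟨L, hL, -, hT, rfl⟩
    rw [SetLike.mem_coe, Submodule.mem_comap, LinearMap.mulLeft_apply]
    rcases L with _ | ⟨p, L⟩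
    · exact mul_word_mem_sup_reducedSpan hφ hk ha isReduced_nil (by simp) (by simp)
    · by_cases hp : k = p.1
      · subst hp
        obtain ⟨h1, h2, h3⟩ := isReduced_cons.1 hL
        rw [List.map_cons, List.prod_cons, ← mul_assoc]
        exact mul_word_mem_sup_reducedSpan hφ hk (Subalgebra.mul_mem _ ha h1.1) h3
          (fun q hq => hT q (by simp [hq])) h2
      · exact mul_word_mem_sup_reducedSpan hφ hk ha hL hT (by simpa using hp)

/-- The elements that map V into itself by left multiplication form a subalgebra containing each `B
k` with k in T; apply them to 1. -/
theorem mem_sup_reducedSpan (hφ : φ 1 = 1) {T : Set κ} {a : A} (ha : a ∈ ⨆ k ∈ T, B k) :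
    a ∈ Submodule.span 𝕜 {(1 : A)} ⊔ reducedSpan φ B T := by
  set V := Submodule.span 𝕜 {(1 : A)} ⊔ reducedSpan φ B T with hV
  let S : Subalgebra 𝕜 A :=
    { carrier := {x | ∀ v ∈ V, x * v ∈ V}
      mul_mem' := fun {x y} hx hy v hv => by
        rw [mul_assoc]
        exact hx _ (hy v hv)
      add_mem' := fun {x y} hx hy v hv => by
        rw [add_mul]
        exact V.add_mem (hx v hv) (hy v hv)
      algebraMap_mem' := fun c v hv => by
        rw [← Algebra.smul_def]
        exact V.smul_mem c hv }
  have hS : ⨆ k ∈ T, B k ≤ S := iSup₂_le fun k hk x hx v hv =>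
    mul_mem_sup_reducedSpan hφ hk hx hv
  have h1 : a * 1 ∈ V := hS ha 1 (Submodule.mem_sup_left (Submodule.subset_span rfl))
  rwa [mul_one] at h1

theorem mem_reducedSpan (hφ : φ 1 = 1) (hB : FreelyIndependent φ B) {T : Set κ} {a : A}
    (ha : a ∈ ⨆ k ∈ T, B k) (ha0 : φ a = 0) : a ∈ reducedSpan φ B T := by
  obtain ⟨y, hy, z, hz, rfl⟩ := Submodule.mem_sup.1 (mem_sup_reducedSpan hφ ha)
  obtain ⟨c, rfl⟩ := Submodule.mem_span_singleton.1 hy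
  rw [map_add, apply_eq_zero_of_mem_headSpan hB (reducedSpan_le_headSpan T hz), add_zero, map_smul,
    hφ, smul_eq_mul, mul_one] at ha0
  rwa [ha0, zero_smul, zero_add]

/-- Words from disjoint groups concatenate to a reduced word. Only the first label of the right
factor matters, which is why `headSpan` records nothing else. -/
theorem mul_mem_headSpan {T T' : Set κ} (hT : Disjoint T T') {a b : A}
    (ha : a ∈ reducedSpan φ B T) (hb : b ∈ headSpan φ B T') : a * b ∈ headSpan φ B T := by
  refine (Submodule.mul_le (P := headSpan φ B T)).1 ?_ a ha b hb
  rw [reducedSpan, headSpan, Submodule.span_mul_span, Submodule.span_le]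
  rintro _ ⟨_, ⟨L, hL, hne, hLT, rfl⟩, _, ⟨M, hM, -, hMT, rfl⟩, rfl⟩
  refine Submodule.subset_span ⟨L ++ M, isReduced_append.2 ⟨hL, hM, fun p hp q hq h => ?_⟩,
    by simp [hne], fun p hp => ?_, by simp⟩
  · exact Set.disjoint_left.1 hT (hLT p (List.mem_of_mem_getLast? hp)) (h ▸ hMT q hq)
  · obtain ⟨q, L, rfl⟩ := List.exists_cons_of_ne_nil hne
    exact hLT p (by simp at hp; simp [hp])

/-- Subalgebras generated by disjoint groups of a freely independent family are freely
independent. -/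
theorem FreelyIndependent.group (hφ : φ 1 = 1) (hB : FreelyIndependent φ B) {κ' : Type*}
    (T : κ' → Set κ) (hT : Pairwise fun i j => Disjoint (T i) (T j)) :
    FreelyIndependent φ fun k' => ⨆ k ∈ T k', B k := by
  intro L hne hch hL
  -- The first group must be remembered so that the induction can attach a factor on the left.
  suffices h : ∀ p ∈ L.head?, (L.map Prod.snd).prod ∈ headSpan φ B (T p.1) by
    obtain ⟨p, M, rfl⟩ := List.exists_cons_of_ne_nil hne
    exact apply_eq_zero_of_mem_headSpan hB (h p (by simp))
  induction L with
  | nil => simp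
  | cons p L ih =>
    intro q hq
    obtain rfl : p = q := by simpa using hq
    have hp := mem_reducedSpan hφ hB (hL p (by simp)).1 (hL p (by simp)).2
    rw [List.map_cons, List.prod_cons]
    rcases L with _ | ⟨r, L⟩
    · simpa using reducedSpan_le_headSpan _ hp
    · rw [List.isChain_cons] at hch
      exact mul_mem_headSpan (hT (hch.1 r (by simp))) hp
        (ih (by simp) hch.2 (fun q hq => hL q (by simp [hq])) r (by simp))

end Grouping

/-! ### Free Lévy processes and martingales -/

section Processes

variable {𝕜 : Type*} [RCLike 𝕜] {A : Type*} [Ring A] [Algebra 𝕜 A] {φ : A →ₗ[𝕜] 𝕜}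

theorem exists_finset_mem_adjoin {ι : Type*} [DecidableEq ι] {X : ι → A} {S : Set ι} {a : A}
    (ha : a ∈ Algebra.adjoin 𝕜 (X '' S)) :
    ∃ F : Finset ι, ↑F ⊆ S ∧ a ∈ Algebra.adjoin 𝕜 (X '' F) := by
  induction ha using Algebra.adjoin_induction with
  | mem x hx =>
    obtain ⟨r, hr, rfl⟩ := hx
    exact ⟨{r}, by simpa using hr, Algebra.subset_adjoin ⟨r, by simp, rfl⟩⟩
  | algebraMap c => exact ⟨∅, by simp, Subalgebra.algebraMap_mem _ c⟩
  | add x y _ _ hx hy =>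
    obtain ⟨F, hF, hxF⟩ := hx
    obtain ⟨G, hG, hyG⟩ := hy
    refine ⟨F ∪ G, by simp [hF, hG], Subalgebra.add_mem _ ?_ ?_⟩
    · exact Algebra.adjoin_mono (Set.image_mono (by simp)) hxF
    · exact Algebra.adjoin_mono (Set.image_mono (by simp)) hyG
  | mul x y _ _ hx hy =>
    obtain ⟨F, hF, hxF⟩ := hx
    obtain ⟨G, hG, hyG⟩ := hy
    refine ⟨F ∪ G, by simp [hF, hG], Subalgebra.mul_mem _ ?_ ?_⟩
    · exact Algebra.adjoin_mono (Set.image_mono (by simp)) hxF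
    · exact Algebra.adjoin_mono (Set.image_mono (by simp)) hyG

theorem mem_vecCons_iff {C D : Subalgebra 𝕜 A} {i : Fin 2} {a : A} :
    a ∈ (![C, D] : Fin 2 → Subalgebra 𝕜 A) i ↔ (i = 0 → a ∈ C) ∧ (i = 1 → a ∈ D) := by
  induction i using Fin.cases with
  | zero => simp
  | succ i => simp [Subsingleton.elim i 0]

/-- Freeness from an algebra with many generators is freeness from finitely many of them. -/
theorem freelyIndependent_adjoin_of_finset {ι : Type*} {X : ι → A} {S : Set ι}
    {C : Subalgebra 𝕜 A}
    (h : ∀ F : Finset ι, ↑F ⊆ S → FreelyIndependent φ ![Algebra.adjoin 𝕜 (X '' F), C]) :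
    FreelyIndependent φ ![Algebra.adjoin 𝕜 (X '' S), C] := by
  classical
  intro L hne hch hL
  -- A word has finitely many letters, each involving finitely many generators, so one finite set
  -- serves them all.
  suffices h' : ∀ M : List (Fin 2 × A), (∀ p ∈ M, p ∈ L) → ∃ F : Finset ι, ↑F ⊆ S ∧
      ∀ p ∈ M, p.2 ∈ (![Algebra.adjoin 𝕜 (X '' F), C] : Fin 2 → Subalgebra 𝕜 A) p.1 by
    obtain ⟨F, hF, hFL⟩ := h' L fun _ => id
    exact h F hF L hne hch fun p hp => ⟨hFL p hp, (hL p hp).2⟩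
  intro M
  induction M with
  | nil => exact fun _ => ⟨∅, by simp, by simp⟩
  | cons p M ih =>
    intro hM
    obtain ⟨F, hF, hFM⟩ := ih fun q hq => hM q (by simp [hq])
    have hmono : ∀ G : Finset ι, F ⊆ G → ∀ q ∈ M,
        q.2 ∈ (![Algebra.adjoin 𝕜 (X '' G), C] : Fin 2 → Subalgebra 𝕜 A) q.1 := fun G hG q hq =>
      mem_vecCons_iff.2 ⟨fun h0 => Algebra.adjoin_mono (Set.image_mono (Finset.coe_subset.2 hG))
        ((mem_vecCons_iff.1 (hFM q hq)).1 h0), (mem_vecCons_iff.1 (hFM q hq)).2⟩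
    have hp := mem_vecCons_iff.1 (hL p (hM p (by simp))).1
    by_cases hk : p.1 = 0
    · obtain ⟨G, hG, haG⟩ := exists_finset_mem_adjoin (hp.1 hk)
      refine ⟨F ∪ G, by simp [hF, hG], List.forall_mem_cons.2
        ⟨mem_vecCons_iff.2 ⟨fun _ => Algebra.adjoin_mono (Set.image_mono (by simp)) haG, hp.2⟩,
          hmono _ (by simp)⟩⟩
    · exact ⟨F, hF, List.forall_mem_cons.2
        ⟨mem_vecCons_iff.2 ⟨fun h0 => absurd h0 hk, hp.2⟩, hmono F subset_rfl⟩⟩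

open scoped NNReal

theorem IsFreeLevyProcess.freelyIndependent_finset {X : ℝ≥0 → A} (hφ : φ 1 = 1)
    (hX : IsFreeLevyProcess φ X) {s t : ℝ≥0} (hst : s ≤ t) {F : Finset ℝ≥0}
    (hF : ↑F ⊆ Set.Iic s) :
    FreelyIndependent φ ![Algebra.adjoin 𝕜 (X '' F), Algebra.adjoin 𝕜 {X t - X s}] := by
  classical
  -- The point 0 lets each X r telescope from X 0 = 0 into increments; the point s makes X t - X s
  -- the last increment once t is appended.
  set G : Finset ℝ≥0 := insert 0 (insert s F) with hG
  have hGs : ∀ r ∈ G, r ≤ s := by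
    intro r hr
    rw [hG, Finset.mem_insert, Finset.mem_insert] at hr
    rcases hr with rfl | rfl | hr
    · exact zero_le
    · exact le_rfl
    · exact hF hr
  obtain ⟨m, hm⟩ : ∃ m, G.card = m + 1 :=
    Nat.exists_eq_succ_of_ne_zero (Finset.card_ne_zero_of_mem (Finset.mem_insert_self _ _))
  set e := G.orderEmbOfFin hm with he
  have hran : ∀ r ∈ G, ∃ i, e i = r := by
    intro r hr
    have : r ∈ Set.range e := by rw [he, Finset.range_orderEmbOfFin]; exact hr
    exact this
  have h0 : e 0 = 0 := by
    obtain ⟨i, hi⟩ := hran 0 (Finset.mem_insert_self _ _)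
    exact le_antisymm (hi ▸ e.monotone (Fin.zero_le i)) zero_le
  have hlast : e (Fin.last m) = s := by
    obtain ⟨i, hi⟩ := hran s (by simp [hG])
    refine le_antisymm (hGs _ (Finset.orderEmbOfFin_mem _ _ _)) ?_
    rw [← hi]
    exact e.monotone (Fin.le_last i)
  set τ : Fin (m + 1 + 1) → ℝ≥0 := Fin.snoc (α := fun _ => ℝ≥0) e t with hτ
  have hτm : Monotone τ := by
    intro i j hij
    induction j using Fin.lastCases with
    | last =>
      induction i using Fin.lastCases with
      | last => exact le_rfl
      | cast i =>
        rw [hτ, Fin.snoc_castSucc, Fin.snoc_last]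
        exact (hGs _ (Finset.orderEmbOfFin_mem _ _ _)).trans hst
    | cast j =>
      induction i using Fin.lastCases with
      | last => exact absurd hij (not_le.2 (Fin.castSucc_lt_last j))
      | cast i =>
        rw [hτ, Fin.snoc_castSucc, Fin.snoc_castSucc]
        exact e.monotone (Fin.castSucc_le_castSucc_iff.1 hij)
  have hfree := hX.free_increments (m + 1) τ hτm
  -- Group the increments up to time s against the last one.
  have hgroup := FreelyIndependent.group hφ hfree
    (![{i | i ≠ Fin.last m}, {Fin.last m}] : Fin 2 → Set (Fin (m + 1))) (by
      intro i j hij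
      fin_cases i <;> fin_cases j <;> simp at hij ⊢)
  refine hgroup.mono fun k => ?_
  fin_cases k
  · refine Algebra.adjoin_le ?_
    rintro _ ⟨r, hr, rfl⟩
    obtain ⟨i, rfl⟩ := hran r (by simp [hG, Finset.mem_coe.1 hr])
    clear hr
    induction i using Fin.induction with
    | zero =>
      rw [h0, hX.zero]
      exact Subalgebra.zero_mem _
    | succ i ih =>
      have h1 : X (e i.succ) = X (e i.castSucc) + (X (τ i.castSucc.succ) -
          X (τ i.castSucc.castSucc)) := by
        rw [hτ, Fin.succ_castSucc, Fin.snoc_castSucc, Fin.snoc_castSucc]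
        abel
      rw [h1]
      refine Subalgebra.add_mem _ ih ?_
      refine (le_iSup₂_of_le (f := fun k (_ : k ∈ {i | i ≠ Fin.last m}) => Algebra.adjoin 𝕜
        ({X (τ k.succ) - X (τ k.castSucc)} : Set A)) i.castSucc
        (Fin.castSucc_lt_last i).ne le_rfl) ?_
      exact Algebra.subset_adjoin rfl
  · refine Algebra.adjoin_le (Set.singleton_subset_iff.2 ?_)
    refine (le_iSup₂_of_le (f := fun k (_ : k ∈ ({Fin.last m} : Set (Fin (m + 1)))) =>
      Algebra.adjoin 𝕜 ({X (τ k.succ) - X (τ k.castSucc)} : Set A)) (Fin.last m) rfl le_rfl) ?_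
    refine Algebra.subset_adjoin ?_
    rw [hτ, Fin.succ_last, Fin.snoc_last, Fin.snoc_castSucc, hlast]
    rfl

theorem isMartingale_appellOne_of_free (hφ : φ 1 = 1) {B : ℝ≥0 → Subalgebra 𝕜 A} {X : ℝ≥0 → A}
    (hX : ∀ t, X t ∈ B t)
    (hB : ∀ s t, s ≤ t → FreelyIndependent φ ![B s, Algebra.adjoin 𝕜 {X t - X s}]) (n : ℕ) :
    IsMartingale φ B fun t => appellOne φ n (X t) := by
  intro s t hst
  have h := isCondExp_appellOne_add hφ (hB s t hst) (i := 0) (j := 1) (by simp) (x := X s)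
    (y := X t - X s) (hX s) (Algebra.subset_adjoin rfl) n
  rw [add_sub_cancel] at h
  exact h

/-- The free Appell polynomials of a free Lévy process are martingales. -/
theorem IsFreeLevyProcess.isMartingale_appellOne (hφ : φ 1 = 1) {X : ℝ≥0 → A}
    (hX : IsFreeLevyProcess φ X) (n : ℕ) :
    IsMartingale φ (inducedFiltration 𝕜 X) fun t => appellOne φ n (X t) :=
  isMartingale_appellOne_of_free hφ (B := inducedFiltration 𝕜 X)
    (fun _ => Algebra.subset_adjoin (Set.mem_image_of_mem X (Set.mem_Iic.2 le_rfl)))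
    (fun _ _ hst => freelyIndependent_adjoin_of_finset fun _ hF =>
      hX.freelyIndependent_finset hφ hst hF) n

end Processes

end FreeAppell

theorem mainTheorem4 {𝕜 : Type*} [RCLike 𝕜] {A : Type*} [Ring A] [Algebra 𝕜 A]
    (φ : A →ₗ[𝕜] 𝕜) (hφ : φ 1 = 1) :
    -- factorization along the classes of a partition
    (∀ (n : ℕ) (X : Fin n → A) (π : Setoid (Fin n)),
      FreeAppell.FreelyIndependentSets φ
        (fun q : Quotient π => {a | ∃ i, Quotient.mk π i = q ∧ X i = a}) →
      ∀ u : List (Fin n),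
        FreeAppell.appell φ (u.map X) =
          ((FreeAppell.classBlocks π u).map fun v => FreeAppell.appell φ (v.map X)).prod) ∧
    -- the free binomial formula
    (∀ X Y : A, FreeAppell.FreelyIndependentSets φ ![{X}, {Y}] → ∀ n : ℕ, 1 ≤ n →
      FreeAppell.appellOne φ n (X + Y) = FreeAppell.appell φ (List.replicate n (X + Y)) ∧
      FreeAppell.appellOne φ n (X + Y) =
        ∑ k ∈ Finset.Icc 1 n, ∑ u : Composition n with u.length = k,
          (FreeAppell.altProd (fun j => FreeAppell.appellOne φ j X)
              (fun j => FreeAppell.appellOne φ j Y) u.blocks +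
            FreeAppell.altProd (fun j => FreeAppell.appellOne φ j Y)
              (fun j => FreeAppell.appellOne φ j X) u.blocks)) ∧
    -- the martingale property, for the induced filtration
    (∀ X : NNReal → A, FreeAppell.IsFreeLevyProcess φ X → ∀ n : ℕ,
      FreeAppell.IsMartingale φ (FreeAppell.inducedFiltration 𝕜 X)
        (fun t => FreeAppell.appellOne φ n (X t))) ∧
    -- the martingale property, for any filtration from which the increments are free
    (∀ (B : NNReal → Subalgebra 𝕜 A) (X : NNReal → A), FreeAppell.IsFreeLevyProcessFor φ B X →
      ∀ n : ℕ, FreeAppell.IsMartingale φ B (fun t => FreeAppell.appellOne φ n (X t))) := by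
  refine ⟨fun n X π h u => FreeAppell.appell_eq_prod_classBlocks hφ X π h u,
    fun X Y h n hn => ⟨FreeAppell.appellOne_eq_appell hφ _ n, ?_⟩,
    fun X hX n => hX.isMartingale_appellOne hφ n,
    fun B X hX n => FreeAppell.isMartingale_appellOne_of_free hφ hX.adapted hX.free_increments n⟩
  rw [← FreeAppell.altSum_add_altSum_eq_sum_length _ _ hn]
  exact FreeAppell.appellOne_add hφ h (i := 0) (j := 1) (by simp) (Algebra.subset_adjoin rfl)
    (Algebra.subset_adjoin rfl) (by omega)
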